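/- Fix $N$ and index coordinates by pairs $(i,j)$ with $1\le i\le j\le N$, writing $x_i^j$. Let $\mathbb{GT}^{(N)}$ be the set of integer arrays with $x_{i-1}^{j-1}\le x_i^j$ (for $i>1$) and $x_i^j<x_i^{j-1}$ (for $i<j$). Let $D([0,\infty),\mathbb R^{N(N+1)/2})$ be the space of càdlàg functions with the topology of uniform convergence on compact sets and the $\sigma$-algebra generated by the coordinate projections; laws $\mu_n$ on it converge to a law $\mu$ if $\int f\,d\mu_n\to\int f\,d\mu$ for every bounded, continuous, measurable $f$. **Interlacing dynamics.** Let $X$ be a càdlàg $\mathbb Z^{N(N+1)/2}$-valued process with unit steps, i.e. $|X_i^j(t)-X_i^j(t-)|\le 1$ for all $t,i,j$. The interlacing dynamics $\mathcal X$ driven by $X$ is the càdlàg process with $\mathcal X(0)\in\mathbb{GT}^{(N)}$ that is constant on every interval on which $X$ is constant and that, at a discontinuity $t$ of $X$, is updated level by level ($k=1,\dots,N$) according to the first rule that applies, where $\Delta=X_i^k(t)-X_i^k(t-)$: (1) if $i>1$ and $\mathcal X_i^k(t-)=\mathcal X_{i-1}^{k-1}(t)-1$, then $\mathcal X_i^k(t)=\mathcal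 X_i^k(t-)+1$; (2) if $i<k$ and $\mathcal X_i^k(t-)=\mathcal X_i^{k-1}(t)$, then $\mathcal X_i^k(t)=\mathcal X_i^k(t-)-1$; (3) if $\Delta=1$, then $\mathcal X_i^k(t)=\mathcal X_i^k(t-)$ when $i<k$ and $\mathcal X_i^{k-1}(t)=\mathcal X_i^k(t-)+1$, and $\mathcal X_i^k(t)=\mathcal X_i^k(t-)+1$ otherwise; (4) if $\Delta=-1$, then $\mathcal X_i^k(t)=\mathcal X_i^k(t-)$ when $i>1$ and $\mathcal X_{i-1}^{k-1}(t)=\mathcal X_i^k(t-)$, and $\mathcal X_i^k(t)=\mathcal X_i^k(t-)-1$ otherwise; (5) if $\Delta=0$, then $\mathcal X_i^k(t)=\mathcal X_i^k(t-)$. **The process $W$.** Given independent standard Brownian motions $B_i^j$ and an initial condition $W(0)$ independent of them, $W$ is the process in which each $W_i^j$ is the Brownian motion $W_i^j(0)+B_i^j$ reflected in the time-dependent interval $[W_{i-1}^{j-1}(t),W_i^{j-1}(t)]$ (with left end $-\infty$ if $i=1$ and right end $+\infty$ if $i=j$). Here $\phi$ is the reflection of $\psi$ in $[l(t),r(t)]$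 if $l\le\phi\le r$ and $\eta=\phi-\psi$ (with $\eta(0-)=0$) satisfies: for $s\le t$, $\eta(t)\ge\eta(s)$ if $\phi<r$ on $(s,t]$ and $\eta(t)\le\eta(s)$ if $\phi>l$ on $(s,t]$; for all $t$, $\eta(t)\ge\eta(t-)$ if $\phi(t)<r(t)$ and $\eta(t)\le\eta(t-)$ if $\phi(t)>l(t)$. **Theorem.** Let $X(\cdot;n)$, $n\in\mathbb N$, be càdlàg $\mathbb Z^{N(N+1)/2}$-valued processes with unit steps in each coordinate, and let $\mathcal X(\cdot;n)$ be the interlacing dynamics driven by $X(\cdot;n)$, with random initial conditions $\mathcal X(0;n)\in\mathbb{GT}^{(N)}$ that are independent of the increments of $X(\cdot;n)$. Suppose that there are continuous functions $a_n:[0,\infty)\to\mathbb R$ and positive reals $b_n\to\infty$ such that the law of $(X(\cdot;n)-a_n(\cdot))/b_n$ on $D([0,\infty),\mathbb R^{N(N+1)/2})$ converges to the law of a standard $N(N+1)/2$-dimensional Brownian motion, and the law of $(\mathcal X(0;n)-a_n(0))/b_n$ converges to some probability law $\mu_0$. (In both expressions the scalar $a_n$ is subtracted from every coordinate.) Then each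 $\mathcal X(\cdot;n)$ is a stochastic process (i.e. measurable), the process $W$ whose initial condition has law $\mu_0$ exists, and the law of $(\mathcal X(\cdot;n)-a_n(\cdot))/b_n$ on $D([0,\infty),\mathbb R^{N(N+1)/2})$ converges to the law of $W$. -/

import Mathlib

open MeasureTheory ProbabilityTheory Filter Topology
open scoped NNReal UniformConvergence

noncomputable section

/-- A function on `[0, ∞)` is càdlàg if it is right-continuous and has left limits. -/
def IsCadlag {E : Type*} [TopologicalSpace E] (f : ℝ≥0 → E) : Prop :=
  ∀ t, ContinuousWithinAt f (Set.Ici t) t ∧ ∃ c, Tendsto f (𝓝[<] t) (𝓝 c)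

/-- The path space `D([0, ∞), E)`. -/
@[ext]
structure CadlagPath (E : Type*) [TopologicalSpace E] where
  toFun : ℝ≥0 → E
  cadlag : IsCadlag toFun

namespace CadlagPath

instance {E : Type*} [TopologicalSpace E] : CoeFun (CadlagPath E) (fun _ => ℝ≥0 → E) :=
  ⟨CadlagPath.toFun⟩

/-- The topology of uniform convergence on compact subsets of `[0, ∞)`. -/
instance {E : Type*} [UniformSpace E] : TopologicalSpace (CadlagPath E) :=
  TopologicalSpace.induced
    (fun x => UniformOnFun.ofFun {K : Set ℝ≥0 | IsCompact K} x.toFun) inferInstance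

/-- The σ-algebra generated by the coordinate projections `x ↦ x t`. -/
instance {E : Type*} [TopologicalSpace E] [MeasurableSpace E] : MeasurableSpace (CadlagPath E) :=
  MeasurableSpace.comap CadlagPath.toFun MeasurableSpace.pi

end CadlagPath

/-- Weak convergence of measures: the integrals of all bounded continuous measurable functions
converge. On a path space with the locally uniform topology the open sets need not be measurable
for the projection σ-algebra (on which the laws of processes live), so measurability of the test
functions is required separately. -/
def WeaklyConverges {S : Type*} [TopologicalSpace S] [MeasurableSpace S]
    (μ : ℕ → Measure S) (ν : Measure S) : Prop :=
  ∀ f : S → ℝ, Continuous f → Measurable f → (∃ C : ℝ, ∀ x, |f x| ≤ C) →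
    Tendsto (fun n => ∫ x, f x ∂(μ n)) atTop (𝓝 (∫ x, f x ∂ν))

/-- The labels of the `N (N + 1) / 2` particles: the particle `x_i^j` has level `j = level` and
index `i = idx`, with `1 ≤ i ≤ j ≤ N`. -/
@[ext]
structure Particle (N : ℕ) where
  level : ℕ
  idx : ℕ
  one_le_idx : 1 ≤ idx
  idx_le_level : idx ≤ level
  level_le : level ≤ N

namespace Particle

instance (N : ℕ) : Finite (Particle N) := by
  refine Finite.of_injective (β := Fin (N + 1) × Fin (N + 1))
    (fun v => (⟨v.level, by have := v.level_le; omega⟩,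
      ⟨v.idx, by have := v.idx_le_level; have := v.level_le; omega⟩)) fun v w h => ?_
  simp only [Prod.mk.injEq, Fin.mk.injEq] at h
  exact Particle.ext h.1 h.2

/-- For the particle `x_i^j` with `i > 1`, the particle `x_{i-1}^{j-1}`. -/
def lower {N : ℕ} (v : Particle N) (h : 1 < v.idx) : Particle N where
  level := v.level - 1
  idx := v.idx - 1
  one_le_idx := by omega
  idx_le_level := by have := v.idx_le_level; omega
  level_le := by have := v.level_le; omega

/-- For the particle `x_i^j` with `i < j`, the particle `x_i^{j-1}`. -/
def upper {N : ℕ} (v : Particle N) (h : v.idx < v.level) : Particle N where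
  level := v.level - 1
  idx := v.idx
  one_le_idx := v.one_le_idx
  idx_le_level := by omega
  level_le := by have := v.level_le; omega

end Particle

/-- Gelfand-Tsetlin patterns of size `N`: integer arrays with
`x_{i-1}^{j-1} ≤ x_i^j` (for `i > 1`) and `x_i^j < x_i^{j-1}` (for `i < j`). -/
def IsGelfandTsetlin {N : ℕ} (x : Particle N → ℤ) : Prop :=
  ∀ v, (∀ h : 1 < v.idx, x (v.lower h) ≤ x v) ∧ (∀ h : v.idx < v.level, x v < x (v.upper h))

/-- Regular driving paths: each coordinate has jumps of size at most one.
(`Function.leftLim x t` is `x (t-)` for `t > 0`, and `x 0` for `t = 0`.) -/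
def HasUnitSteps {N : ℕ} (x : CadlagPath (Particle N → ℤ)) : Prop :=
  ∀ t v, |x t v - Function.leftLim x t v| ≤ 1

/-- The sequential update: `z` is the configuration obtained from the configuration `y` when the
driving processes jump by `d`. The new position of a particle depends on the new positions
of its two neighbours on the level below, so `z` is determined level by level. -/
def IsSequentialUpdate {N : ℕ} (y d z : Particle N → ℤ) : Prop :=
  ∀ v : Particle N, z v =
    if ∃ h : 1 < v.idx, y v = z (v.lower h) - 1 then y v + 1
    else if ∃ h : v.idx < v.level, y v = z (v.upper h) then y v - 1
    else if d v = 1 then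
      (if ∃ h : v.idx < v.level, z (v.upper h) = y v + 1 then y v else y v + 1)
    else if d v = -1 then
      (if ∃ h : 1 < v.idx, z (v.lower h) = y v then y v else y v - 1)
    else y v

/-- `y` is a path of the interlacing dynamics driven by the path `x`. -/
structure IsInterlacingDynamics {N : ℕ} (x y : CadlagPath (Particle N → ℤ)) : Prop where
  init : IsGelfandTsetlin (y 0)
  const : ∀ t₁ t₂ : ℝ≥0, t₁ ≤ t₂ → (∀ t ∈ Set.Icc t₁ t₂, x t = x t₁) →
    ∀ t ∈ Set.Icc t₁ t₂, y t = y t₁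
  jump : ∀ t : ℝ≥0, x t ≠ Function.leftLim x t →
    IsSequentialUpdate (Function.leftLim y t) (x t - Function.leftLim x t) (y t)

theorem isCadlag_rescale {N : ℕ} (a : C(ℝ≥0, ℝ)) (b : ℝ) (x : CadlagPath (Particle N → ℤ)) :
    IsCadlag (fun t v => ((x t v : ℝ) - a t) / b : ℝ≥0 → Particle N → ℝ) := by
  intro t
  obtain ⟨h1, c, h2⟩ := x.cadlag t
  constructor
  · refine continuousWithinAt_pi.2 fun v => ?_
    have h3 : ContinuousWithinAt (fun s => ((x s v : ℤ) : ℝ)) (Set.Ici t) t :=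
      (continuous_of_discreteTopology (f := fun m : ℤ => (m : ℝ))).continuousAt
        |>.comp_continuousWithinAt (continuousWithinAt_pi.1 h1 v)
    exact (h3.sub a.continuous.continuousWithinAt).div_const b
  · refine ⟨fun v => ((c v : ℝ) - a t) / b, tendsto_pi_nhds.2 fun v => ?_⟩
    have h3 : Tendsto (fun s => ((x s v : ℤ) : ℝ)) (𝓝[<] t) (𝓝 (c v : ℝ)) :=
      ((continuous_of_discreteTopology (f := fun m : ℤ => (m : ℝ))).tendsto (c v)).comp
        (tendsto_pi_nhds.1 h2 v)
    exact (h3.sub ((a.continuous.tendsto t).mono_left nhdsWithin_le_nhds)).div_const b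

/-- The rescaled path `t ↦ (x(t) - a(t)) / b`. -/
def rescalePath {N : ℕ} (a : C(ℝ≥0, ℝ)) (b : ℝ) (x : CadlagPath (Particle N → ℤ)) :
    CadlagPath (Particle N → ℝ) where
  toFun t v := ((x t v : ℝ) - a t) / b
  cadlag := isCadlag_rescale a b x

/-- Standard Brownian motion in `ℝ^ι` (started at `0`): the coordinates are independent
one-dimensional standard Brownian motions. -/
structure IsStandardBrownianMotion {ι Ω : Type*} [MeasurableSpace Ω]
    (B : ℝ≥0 → Ω → ι → ℝ) (P : Measure Ω) : Prop where
  isProbabilityMeasure : IsProbabilityMeasure P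
  measurable : ∀ t, Measurable (B t)
  brownian : ∀ v, IsBrownianReal (fun t ω => B t ω v) P
  indep : iIndepFun (fun v ω (t : ℝ≥0) => B t ω v) P

/-- `φ` is the (extended Skorokhod) reflection of the path `ψ` in the time-dependent interval
`[l(t), r(t)]`, with constraining term `η = φ - ψ` and the convention `η(0-) = 0`. -/
structure IsReflection (l r : ℝ≥0 → EReal) (ψ φ : ℝ≥0 → ℝ) : Prop where
  lower_le : ∀ t, l t ≤ (φ t : EReal)
  le_upper : ∀ t, (φ t : EReal) ≤ r t
  mono : ∀ s t, s ≤ t → (∀ u ∈ Set.Ioc s t, (φ u : EReal) < r u) → φ s - ψ s ≤ φ t - ψ t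
  anti : ∀ s t, s ≤ t → (∀ u ∈ Set.Ioc s t, l u < (φ u : EReal)) → φ t - ψ t ≤ φ s - ψ s
  jump_nonneg : ∀ t, 0 < t → (φ t : EReal) < r t →
    Function.leftLim (fun s => φ s - ψ s) t ≤ φ t - ψ t
  jump_nonpos : ∀ t, 0 < t → l t < (φ t : EReal) →
    φ t - ψ t ≤ Function.leftLim (fun s => φ s - ψ s) t
  zero_nonneg : (φ 0 : EReal) < r 0 → 0 ≤ φ 0 - ψ 0
  zero_nonpos : l 0 < (φ 0 : EReal) → φ 0 - ψ 0 ≤ 0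

/-- The left barrier of the particle `v`: `w_{i-1}^{j-1}`, or `-∞` if `i = 1`. -/
def leftBarrier {N : ℕ} (w : ℝ≥0 → Particle N → ℝ) (v : Particle N) (t : ℝ≥0) : EReal :=
  if h : 1 < v.idx then ((w t (v.lower h) : ℝ) : EReal) else ⊥

/-- The right barrier of the particle `v`: `w_i^{j-1}`, or `+∞` if `i = j`. -/
def rightBarrier {N : ℕ} (w : ℝ≥0 → Particle N → ℝ) (v : Particle N) (t : ℝ≥0) : EReal :=
  if h : v.idx < v.level then ((w t (v.upper h) : ℝ) : EReal) else ⊤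

/-- `W` is the process of reflected interlacing Brownian motions driven by `B`: every component
`W_i^j` is the Brownian motion `B_i^j`, started from `W_i^j(0)`, reflected on the trajectories of
`W_{i-1}^{j-1}` (from below, if `i > 1`) and `W_i^{j-1}` (from above, if `i < j`), and the initial
condition is independent of `B`. In particular `w_{i-1}^{j-1} ≤ w_i^j ≤ w_i^{j-1}` at all times. -/
structure IsWarrenProcess {N : ℕ} {Ω : Type*} [MeasurableSpace Ω]
    (B : ℝ≥0 → Ω → Particle N → ℝ) (W : Ω → CadlagPath (Particle N → ℝ))
    (P : Measure Ω) : Prop where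
  brownian : IsStandardBrownianMotion B P
  measurable : Measurable W
  indep_init : IndepFun (fun ω => W ω 0) (fun ω t => B t ω) P
  reflected : ∀ᵐ ω ∂P, ∀ v, IsReflection (leftBarrier (W ω) v) (rightBarrier (W ω) v)
    (fun t => W ω 0 v + B t ω v) (fun t => W ω t v)

/-- `ν` is the law of the process `W` of reflected interlacing Brownian motions whose initial
condition has law `μ₀`. -/
def IsWarrenLaw {N : ℕ} (μ₀ : Measure (Particle N → ℝ))
    (ν : Measure (CadlagPath (Particle N → ℝ))) : Prop :=
  ∃ (Ω : Type) (_ : MeasurableSpace Ω) (P : Measure Ω) (B : ℝ≥0 → Ω → Particle N → ℝ)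
    (W : Ω → CadlagPath (Particle N → ℝ)),
    IsWarrenProcess B W P ∧ P.map (fun ω => W ω 0) = μ₀ ∧ ν = P.map W

end

/-! The discrete dynamics already is a reflection. A particle that does not follow its driver has
been blocked or pushed, and it then sits right next to the neighbour responsible. So `y - x` can
drop at a particle only if the particle ends one step below its upper neighbour, and can grow only
if it ends level with its lower neighbour. After rescaling, the dynamics is an `IsReflectedSystem`
with gap `1 / b`, and `W` is one with gap `0`; the scalar `a` cancels because it is the same in
every coordinate.

Reflected systems are Lipschitz in the driver and in the gap, uniformly on `[0, T]`
(`IsReflectedSystem.abs_sub_le`): where two solutions are too far apart, the constraining terms can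
only bring them closer. Freezing the driver at grid points yields `gridPath`, a continuous function
of the initial condition and of the grid increments. It is close to the true solution as soon as the
driver oscillates little between grid points and the gap is small
(`IsReflectedSystem.gridPath_close`).

By independence, initial conditions and grid increments converge jointly. The grid oscillation is a
bounded, continuous, measurable functional, so its mean under the rescaled drivers tends to its mean
under Brownian motion, which is small on a fine grid; Markov's inequality then controls the
approximation error for all large `n`. `tendsto_integral_of_approximation` concludes. Portmanteau is
applied only to the grid data, so the path space need not be separable.

The Lipschitz bound also constructs `W`, as a limit of grid paths driven by Brownian motion. The
discrete dynamics is measurable because on a fine enough grid it follows the one-step update rule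
exactly. -/

/-! ### Monotonicity arguments on intervals -/

/-- If `p t` fails, let `s` be the infimum of the `x` such that `p` fails on `(x, t]`. Then `p s`
fails by `hr`, so by `hl` it also fails just to the left of `s`, and `s` was not the infimum. -/
theorem interval_induction {p : ℝ≥0 → Prop} {a T : ℝ≥0} (ha : p a)
    (hl : ∀ t, a < t → t ≤ T → (∃ᶠ s in 𝓝[<] t, p s) → p t)
    (hr : ∀ s t, a ≤ s → s < t → t ≤ T → p s → ∃ u ∈ Set.Ioc s t, p u) :
    ∀ t, a ≤ t → t ≤ T → p t := by
  intro t hat htT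
  by_contra hpt
  set S : Set ℝ≥0 := {x | a ≤ x ∧ x ≤ t ∧ ∀ u ∈ Set.Ioc x t, ¬ p u} with hS
  have htS : t ∈ S := ⟨hat, le_rfl, fun u hu => absurd hu.1 (not_lt.2 hu.2)⟩
  have hbdd : BddBelow S := OrderBot.bddBelow S
  set s := sInf S with hs
  have hst : s ≤ t := csInf_le hbdd htS
  have has : a ≤ s := le_csInf ⟨t, htS⟩ fun x hx => hx.1
  have hgt : ∀ u ∈ Set.Ioc s t, ¬ p u := by
    intro u hu
    obtain ⟨x, hxS, hxu⟩ := exists_lt_of_csInf_lt ⟨t, htS⟩ hu.1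
    exact hxS.2.2 u ⟨hxu, hu.2⟩
  have hps : ¬ p s := by
    intro hps
    have hlt : s < t := lt_of_le_of_ne hst (by rintro h; exact hpt (h ▸ hps))
    obtain ⟨u, hu, hpu⟩ := hr s t has hlt htT hps
    exact hgt u hu hpu
  have has' : a < s := lt_of_le_of_ne has (by rintro h; exact hps (h ▸ ha))
  have hev : ∀ᶠ x in 𝓝[<] s, ¬ p x := by
    by_contra hcon
    exact hps (hl s has' (hst.trans htT) hcon)
  obtain ⟨c, hc, hcs⟩ := (mem_nhdsLT_iff_exists_Ioo_subset' has').1 hev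
  obtain ⟨x, hx1, hx2⟩ := exists_between (max_lt hc has')
  have hxS : x ∈ S := by
    refine ⟨((le_max_right _ _).trans_lt hx1).le, hx2.le.trans hst, fun u hu => ?_⟩
    rcases lt_trichotomy u s with h | h | h
    · exact hcs ⟨((le_max_left _ _).trans_lt hx1).trans hu.1, h⟩
    · rw [h]; exact hps
    · exact hgt u ⟨h, hu.2⟩
  exact absurd (csInf_le hbdd hxS) (not_le.2 hx2)

/-- `η` increases, continuously or by jumps, as long as `U` does not hold. -/
structure NondecreasingOff (η : ℝ≥0 → ℝ) (U : ℝ≥0 → Prop) : Prop where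
  le : ∀ s t, s ≤ t → (∀ u ∈ Set.Ioc s t, ¬ U u) → η s ≤ η t
  left_le : ∀ t, 0 < t → ¬ U t → ∀ c, Tendsto η (𝓝[<] t) (𝓝 c) → c ≤ η t

/-- `η` is a pure jump function: it is locally constant on both sides of every point. -/
structure IsStepFunction {E : Type*} (η : ℝ≥0 → E) : Prop where
  right : ∀ t, ∀ᶠ s in 𝓝[>] t, η s = η t
  left : ∀ t, ∃ c, ∀ᶠ s in 𝓝[<] t, η s = c

theorem NNReal.nhdsLT_neBot {t : ℝ≥0} (ht : 0 < t) : (𝓝[<] t).NeBot :=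
  nhdsLT_neBot_of_exists_lt ⟨0, ht⟩

theorem IsStepFunction.comp {E F : Type*} {η : ℝ≥0 → E} (h : IsStepFunction η) (f : E → F) :
    IsStepFunction (fun t => f (η t)) where
  right t := (h.right t).mono fun s hs => by rw [hs]
  left t := by
    obtain ⟨c, hc⟩ := h.left t
    exact ⟨f c, hc.mono fun s hs => by rw [hs]⟩

theorem IsStepFunction.isCadlag {E : Type*} [TopologicalSpace E] {η : ℝ≥0 → E}
    (h : IsStepFunction η) : IsCadlag η := by
  intro t
  constructor
  · rw [← continuousWithinAt_Ioi_iff_Ici]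
    exact tendsto_const_nhds.congr' ((h.right t).mono fun s hs => hs.symm)
  · obtain ⟨c, hc⟩ := h.left t
    exact ⟨c, tendsto_const_nhds.congr' (hc.mono fun s hs => hs.symm)⟩

theorem IsCadlag.isStepFunction {E : Type*} [TopologicalSpace E] [DiscreteTopology E]
    {η : ℝ≥0 → E} (h : IsCadlag η) : IsStepFunction η where
  right t := by
    have h1 : Tendsto η (𝓝[>] t) (𝓝 (η t)) := continuousWithinAt_Ioi_iff_Ici.2 (h t).1
    rw [nhds_discrete, tendsto_pure] at h1
    exact h1
  left t := by
    obtain ⟨c, hc⟩ := (h t).2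
    rw [nhds_discrete, tendsto_pure] at hc
    exact ⟨c, hc⟩

/-- For a pure jump function only the jumps need checking; interval induction avoids counting them.
-/
theorem IsStepFunction.nondecreasingOff {η : ℝ≥0 → ℝ} {U : ℝ≥0 → Prop} (h : IsStepFunction η)
    (hj : ∀ t, 0 < t → ¬ U t → ∀ c, (∀ᶠ s in 𝓝[<] t, η s = c) → c ≤ η t) :
    NondecreasingOff η U where
  le s t hst hU := by
    refine interval_induction (p := fun x => η s ≤ η x) (a := s) (T := t) le_rfl ?_ ?_ t hst le_rfl
    · intro x hsx hxt hfr
      obtain ⟨c, hc⟩ := h.left x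
      obtain ⟨y, hy1, hy2⟩ := (hfr.and_eventually hc).exists
      rw [hy2] at hy1
      exact hy1.trans (hj x (zero_le.trans_lt hsx) (hU x ⟨hsx, hxt⟩) c hc)
    · intro x y _ hxy _ hp
      have h2 : ∀ᶠ u in 𝓝[>] x, u ∈ Set.Ioc x y := Ioc_mem_nhdsGT hxy
      obtain ⟨u, hu1, hu2⟩ := ((h.right x).and h2).exists
      exact ⟨u, hu2, by simpa only [hu1] using hp⟩
  left_le t ht hU c hc := by
    obtain ⟨c', hc'⟩ := h.left t
    have := NNReal.nhdsLT_neBot ht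
    have : c = c' := tendsto_nhds_unique hc
      (tendsto_const_nhds.congr' (hc'.mono fun s hs => hs.symm))
    exact this ▸ hj t ht hU c' hc'

/-- If the difference `η - η'` exceeds `K` only when `η` cannot increase and `η'` cannot
decrease, then it never exceeds `K`. -/
theorem NondecreasingOff.sub_le {η η' : ℝ≥0 → ℝ} {L U : ℝ≥0 → Prop} {K : ℝ} {T : ℝ≥0}
    (hη : NondecreasingOff (fun t => -η t) L) (hη' : NondecreasingOff η' U)
    (lim : ∀ t, ∃ c, Tendsto η (𝓝[<] t) (𝓝 c)) (lim' : ∀ t, ∃ c, Tendsto η' (𝓝[<] t) (𝓝 c))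
    (h0 : η 0 - η' 0 ≤ K) (hK : ∀ t ≤ T, K < η t - η' t → ¬ L t ∧ ¬ U t) :
    ∀ t ≤ T, η t - η' t ≤ K := by
  intro t ht
  refine interval_induction (p := fun t => η t - η' t ≤ K) (a := 0) (T := T) h0 ?_ ?_ t zero_le ht
  · intro t ht htT hfr
    by_contra! hlt
    obtain ⟨hL, hU⟩ := hK t htT hlt
    obtain ⟨c, hc⟩ := lim t
    obtain ⟨c', hc'⟩ := lim' t
    have h1 := hη.left_le t ht hL (-c) hc.neg
    have h2 := hη'.left_le t ht hU c' hc'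
    -- The jump at `t` cannot have increased the difference, so the bound already fails for the left
    -- limits, hence just before `t`.
    have h3 : K < c - c' := by linarith
    obtain ⟨x, hx1, hx2⟩ := (hfr.and_eventually ((hc.sub hc').eventually (lt_mem_nhds h3))).exists
    exact absurd hx1 (not_le.2 hx2)
  · intro s t _ hst htT hp
    by_contra! hcon
    have h1 := hη.le s t hst.le fun u hu => (hK u (hu.2.trans htT) (hcon u hu)).1
    have h2 := hη'.le s t hst.le fun u hu => (hK u (hu.2.trans htT) (hcon u hu)).2
    have h3 := hcon t ⟨hst, le_rfl⟩
    linarith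

/-! ### Systems of interlacing reflected paths -/

/-- Real arrays with `x_{i-1}^{j-1} ≤ x_i^j ≤ x_i^{j-1}`. -/
def IsInterlaced {N : ℕ} (x : Particle N → ℝ) : Prop :=
  ∀ v, (∀ h : 1 < v.idx, x (v.lower h) ≤ x v) ∧ (∀ h : v.idx < v.level, x v ≤ x (v.upper h))

theorem Particle.level_lower_lt {N : ℕ} (v : Particle N) (h : 1 < v.idx) :
    (v.lower h).level < v.level := by
  have := v.idx_le_level
  simp only [Particle.lower]
  omega

theorem Particle.level_upper_lt {N : ℕ} (v : Particle N) (h : v.idx < v.level) :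
    (v.upper h).level < v.level := by
  have := v.one_le_idx
  simp only [Particle.upper]
  omega

theorem Particle.level_induction {N : ℕ} {p : Particle N → Prop}
    (h : ∀ v, (∀ h : 1 < v.idx, p (v.lower h)) → (∀ h : v.idx < v.level, p (v.upper h)) → p v)
    (v : Particle N) : p v := by
  induction hn : v.level using Nat.strong_induction_on generalizing v with
  | _ n ih =>
    subst hn
    exact h v (fun h => ih _ (v.level_lower_lt h) _ rfl) fun h => ih _ (v.level_upper_lt h) _ rfl

/-- Every `w_i^j` is the reflection of `ψ_i^j` in the interval `[w_{i-1}^{j-1}, w_i^{j-1} - c]`. -/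
structure IsReflectedSystem {N : ℕ} (c : ℝ) (ψ w : ℝ≥0 → Particle N → ℝ) : Prop where
  left_lim : ∀ v t, ∃ a, Tendsto (fun s => w s v - ψ s v) (𝓝[<] t) (𝓝 a)
  zero : ∀ v, w 0 v = ψ 0 v
  lower_le : ∀ t v (h : 1 < v.idx), w t (v.lower h) ≤ w t v
  le_upper : ∀ t v (h : v.idx < v.level), w t v + c ≤ w t (v.upper h)
  push_up : ∀ v, NondecreasingOff (fun t => w t v - ψ t v)
    (fun t => ∃ h : v.idx < v.level, w t v + c = w t (v.upper h))
  push_down : ∀ v, NondecreasingOff (fun t => -(w t v - ψ t v))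
    (fun t => ∃ h : 1 < v.idx, w t (v.lower h) = w t v)

/-- If `w` is more than `E + ε` above `w'`, then `w` cannot touch its lower barrier nor `w'` its
upper one, since the barriers differ by at most `E` and the gaps by at most `ε`. The other two `ε`
come from passing between `w - w'` and the difference of the constraining terms, once in each
direction. -/
theorem IsReflectedSystem.sub_le {N : ℕ} {c c' : ℝ} {ψ ψ' w w' : ℝ≥0 → Particle N → ℝ}
    (hw : IsReflectedSystem c ψ w) (hw' : IsReflectedSystem c' ψ' w') {T : ℝ≥0} {ε E : ℝ}
    (hε : 0 ≤ ε) (hE : 0 ≤ E) (hc : |c - c'| ≤ ε) (hψ : ∀ t ≤ T, ∀ v, |ψ t v - ψ' t v| ≤ ε)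
    (v : Particle N)
    (hlow : ∀ t ≤ T, ∀ h : 1 < v.idx, |w t (v.lower h) - w' t (v.lower h)| ≤ E)
    (hupp : ∀ t ≤ T, ∀ h : v.idx < v.level, |w t (v.upper h) - w' t (v.upper h)| ≤ E) :
    ∀ t ≤ T, w t v - w' t v ≤ E + 3 * ε := by
  intro t ht
  have key := (hw.push_down v).sub_le (hw'.push_up v) (hw.left_lim v) (hw'.left_lim v)
    (K := E + 2 * ε) (T := T) (by simp only [hw.zero, hw'.zero, sub_self]; positivity) ?_ t ht
  · have := abs_le.1 (hψ t ht v)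
    linarith
  · intro t ht hlt
    have h1 := abs_le.1 (hψ t ht v)
    have h2 := abs_le.1 hc
    constructor
    · rintro ⟨h, heq⟩
      have h3 := abs_le.1 (hlow t ht h)
      have h4 := hw'.lower_le t v h
      linarith
    · rintro ⟨h, heq⟩
      have h3 := abs_le.1 (hupp t ht h)
      have h4 := hw.le_upper t v h
      linarith

/-- Lipschitz continuity of the reflection map in the driving path and in the gap. -/
theorem IsReflectedSystem.abs_sub_le {N : ℕ} {c c' : ℝ} {ψ ψ' w w' : ℝ≥0 → Particle N → ℝ}
    (hw : IsReflectedSystem c ψ w) (hw' : IsReflectedSystem c' ψ' w') {T : ℝ≥0} {ε : ℝ}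
    (hε : 0 ≤ ε) (hc : |c - c'| ≤ ε) (hψ : ∀ t ≤ T, ∀ v, |ψ t v - ψ' t v| ≤ ε) :
    ∀ t ≤ T, ∀ v, |w t v - w' t v| ≤ 3 * N * ε := by
  -- The barriers of a particle live one level below, so each level costs one further `3 * ε`.
  have key : ∀ v : Particle N, ∀ t ≤ T, |w t v - w' t v| ≤ 3 * v.level * ε := by
    intro v
    induction v using Particle.level_induction with
    | h v hl hu =>
      have hlev : 1 ≤ v.level := v.one_le_idx.trans v.idx_le_level
      have hE : (3 * (v.level - 1 : ℕ) * ε : ℝ) + 3 * ε = 3 * v.level * ε := by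
        rw [Nat.cast_sub hlev]; push_cast; ring
      have h0 : (0 : ℝ) ≤ 3 * (v.level - 1 : ℕ) * ε := by positivity
      intro t ht
      rw [abs_le, ← hE]
      constructor
      · have := hw'.sub_le hw hε h0 (by rwa [abs_sub_comm])
          (fun t ht v => by rw [abs_sub_comm]; exact hψ t ht v) v
          (fun t ht h => by rw [abs_sub_comm]; exact hl h t ht)
          (fun t ht h => by rw [abs_sub_comm]; exact hu h t ht) t ht
        linarith
      · exact hw.sub_le hw' hε h0 hc hψ v (fun t ht h => hl h t ht) (fun t ht h => hu h t ht) t ht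
  intro t ht v
  refine (key v t ht).trans ?_
  have : (v.level : ℝ) ≤ N := by exact_mod_cast v.level_le
  gcongr

/-! ### The uniform structure of the path space -/

/-- Being a `comap` along the same map, it induces definitionally the topology already chosen on the
path space. -/
instance CadlagPath.instUniformSpace {E : Type*} [UniformSpace E] : UniformSpace (CadlagPath E) :=
  UniformSpace.comap (fun x => UniformOnFun.ofFun {K : Set ℝ≥0 | IsCompact K} x.toFun)
    inferInstance

theorem CadlagPath.hasBasis_uniformity (N : ℕ) :
    (uniformity (CadlagPath (Particle N → ℝ))).HasBasis (fun p : ℝ≥0 × ℝ => 0 < p.2)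
      fun p => {x | ∀ t ≤ p.1, ∀ v, |x.1 t v - x.2 t v| < p.2} := by
  let := Fintype.ofFinite (Particle N)
  have h1 := (UniformOnFun.hasBasis_uniformity_of_basis ℝ≥0 (Particle N → ℝ)
    {K : Set ℝ≥0 | IsCompact K} ⟨∅, isCompact_empty⟩
    (directedOn_of_sup_mem fun _ _ h h' => h.union h') Metric.uniformity_basis_dist).comap
    (fun p : CadlagPath (Particle N → ℝ) × CadlagPath (Particle N → ℝ) =>
      (UniformOnFun.ofFun {K : Set ℝ≥0 | IsCompact K} p.1.toFun,
        UniformOnFun.ofFun {K : Set ℝ≥0 | IsCompact K} p.2.toFun))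
  refine h1.to_hasBasis ?_ ?_
  · rintro ⟨K, ε⟩ ⟨hK, hε⟩
    obtain ⟨T, hT⟩ := IsCompact.bddAbove hK
    refine ⟨(T, ε), hε, fun x hx t ht => ?_⟩
    exact (dist_pi_lt_iff hε).2 fun v => hx t (hT ht) v
  · rintro ⟨T, ε⟩ hε
    refine ⟨(Set.Icc 0 T, ε), ⟨isCompact_Icc, hε⟩, fun x hx t ht v => ?_⟩
    exact (dist_pi_lt_iff hε).1 (hx t ⟨zero_le, ht⟩) v

/-- This provides the pseudometric used in `tendsto_integral_of_approximation`. -/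
instance CadlagPath.isCountablyGenerated_uniformity (N : ℕ) :
    (uniformity (CadlagPath (Particle N → ℝ))).IsCountablyGenerated := by
  refine Filter.HasBasis.isCountablyGenerated (ι := ℕ) (p := fun _ => True)
    (s := fun n => {x | ∀ t ≤ (n : ℝ≥0), ∀ v, |x.1 t v - x.2 t v| < 1 / ((n : ℝ) + 1)}) ?_
  refine (CadlagPath.hasBasis_uniformity N).to_hasBasis ?_ ?_
  · rintro ⟨T, ε⟩ hε
    obtain ⟨n, hn⟩ := exists_nat_one_div_lt hε
    obtain ⟨m, hm⟩ := exists_nat_ge T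
    refine ⟨max n m, trivial, fun x hx t ht v => ?_⟩
    refine (hx t (ht.trans (hm.trans (by exact_mod_cast le_max_right n m))) v).trans_le
      (le_trans ?_ hn.le)
    gcongr
    exact_mod_cast le_max_left n m
  · intro n _
    exact ⟨(n, 1 / ((n : ℝ) + 1)), by positivity, subset_rfl⟩

theorem CadlagPath.tendsto_nhds {N : ℕ} {ι : Type*} {l : Filter ι}
    {f : ι → CadlagPath (Particle N → ℝ)} {x : CadlagPath (Particle N → ℝ)}
    (h : ∀ T : ℝ≥0, ∀ ε > 0, ∀ᶠ i in l, ∀ t ≤ T, ∀ v, |x t v - f i t v| < ε) :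
    Tendsto f l (𝓝 x) :=
  ((nhds_basis_uniformity' (CadlagPath.hasBasis_uniformity N)).tendsto_right_iff).2
    fun p hp => h p.1 p.2 hp

theorem CadlagPath.eventually_nhds {N : ℕ} (x : CadlagPath (Particle N → ℝ)) (T : ℝ≥0) {ε : ℝ}
    (hε : 0 < ε) : ∀ᶠ y in 𝓝 x, ∀ t ≤ T, ∀ v, |x t v - y t v| < ε :=
  (nhds_basis_uniformity' (CadlagPath.hasBasis_uniformity N)).mem_of_mem (i := (T, ε)) hε

theorem CadlagPath.measurable_eval {E : Type*} [TopologicalSpace E] [MeasurableSpace E] (t : ℝ≥0) :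
    Measurable fun x : CadlagPath E => x t :=
  (measurable_pi_apply t).comp (comap_measurable CadlagPath.toFun)

theorem CadlagPath.measurable_toFun {E : Type*} [TopologicalSpace E] [MeasurableSpace E] :
    Measurable (CadlagPath.toFun : CadlagPath E → ℝ≥0 → E) :=
  comap_measurable CadlagPath.toFun

theorem CadlagPath.measurable_iff {E Ω : Type*} [TopologicalSpace E] [MeasurableSpace E]
    [MeasurableSpace Ω] {f : Ω → CadlagPath E} : Measurable f ↔ ∀ t, Measurable fun ω => f ω t :=
  measurable_comap_iff.trans measurable_pi_iff

theorem CadlagPath.continuous_eval {N : ℕ} (t : ℝ≥0) :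
    Continuous fun x : CadlagPath (Particle N → ℝ) => x t := by
  refine continuous_pi fun v => continuous_iff_continuousAt.2 fun x => ?_
  refine Metric.tendsto_nhds.2 fun ε hε => ?_
  filter_upwards [CadlagPath.eventually_nhds x t hε] with y hy
  rw [dist_comm]
  exact hy t le_rfl v

/-! ### The discretized reflection map -/

/-- The index of the last point of the grid of mesh `1 / (k + 1)` before `t`. -/
noncomputable def gridIndex (k : ℕ) (t : ℝ≥0) : ℕ := ⌊((k : ℝ≥0) + 1) * t⌋₊

/-- The points of the grid of mesh `1 / (k + 1)`. -/
noncomputable def gridPoint (k j : ℕ) : ℝ≥0 := j / ((k : ℝ≥0) + 1)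

theorem gridIndex_zero (k : ℕ) : gridIndex k 0 = 0 := by simp [gridIndex]

theorem gridPoint_zero (k : ℕ) : gridPoint k 0 = 0 := by simp [gridPoint]

theorem gridPoint_le (k : ℕ) (t : ℝ≥0) : gridPoint k (gridIndex k t) ≤ t := by
  have hk : (0 : ℝ≥0) < (k : ℝ≥0) + 1 := by positivity
  rw [gridPoint, div_le_iff₀ hk, mul_comm t]
  exact Nat.floor_le zero_le

theorem lt_gridPoint_succ (k : ℕ) (t : ℝ≥0) : t < gridPoint k (gridIndex k t + 1) := by
  have hk : (0 : ℝ≥0) < (k : ℝ≥0) + 1 := by positivity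
  rw [gridPoint, lt_div_iff₀ hk, mul_comm t]
  push_cast
  exact Nat.lt_floor_add_one _

theorem gridIndex_eq_iff (k n : ℕ) (t : ℝ≥0) :
    gridIndex k t = n ↔ gridPoint k n ≤ t ∧ t < gridPoint k (n + 1) := by
  have hk : (0 : ℝ≥0) < (k : ℝ≥0) + 1 := by positivity
  rw [gridPoint, gridPoint, div_le_iff₀ hk, lt_div_iff₀ hk, gridIndex, Nat.floor_eq_iff zero_le,
    mul_comm t]
  push_cast
  rfl

theorem gridIndex_mono (k : ℕ) : Monotone (gridIndex k) := fun _ _ h =>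
  Nat.floor_mono (by gcongr)

theorem gridPoint_strictMono (k : ℕ) : StrictMono (gridPoint k) := fun a b h => by
  have hk : (0 : ℝ≥0) < (k : ℝ≥0) + 1 := by positivity
  unfold gridPoint
  gcongr

theorem gridPoint_succ (k j : ℕ) : gridPoint k (j + 1) = gridPoint k j + gridPoint k 1 := by
  simp [gridPoint, add_div]

theorem eventually_gridIndex_left (k : ℕ) {t : ℝ≥0} (ht : 0 < t) :
    ∃ n, (∀ᶠ s in 𝓝[<] t, gridIndex k s = n) ∧ (gridIndex k t = n ∨ gridIndex k t = n + 1) := by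
  rcases (gridPoint_le k t).lt_or_eq with h | h
  · refine ⟨gridIndex k t, ?_, Or.inl rfl⟩
    filter_upwards [Ico_mem_nhdsLT h] with s hs
    exact (gridIndex_eq_iff _ _ _).2 ⟨hs.1, hs.2.trans (lt_gridPoint_succ k t)⟩
  · obtain ⟨n, hn⟩ : ∃ n, gridIndex k t = n + 1 := by
      refine Nat.exists_eq_succ_of_ne_zero fun h0 => ?_
      rw [h0, gridPoint_zero] at h
      exact ht.ne h
    refine ⟨n, ?_, Or.inr hn⟩
    rw [hn] at h
    have hlt : gridPoint k n < t := h ▸ gridPoint_strictMono k n.lt_succ_self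
    filter_upwards [Ico_mem_nhdsLT hlt] with s hs
    exact (gridIndex_eq_iff _ _ _).2 ⟨hs.1, h ▸ hs.2⟩

theorem isStepFunction_gridIndex (k : ℕ) : IsStepFunction (gridIndex k) where
  right t := by
    filter_upwards [Ioo_mem_nhdsGT (lt_gridPoint_succ k t)] with s hs
    exact (gridIndex_eq_iff _ _ _).2 ⟨(gridPoint_le k t).trans hs.1.le, hs.2⟩
  left t := by
    rcases eq_or_ne t 0 with rfl | ht
    · exact ⟨0, by simp⟩
    · obtain ⟨n, hn, -⟩ := eventually_gridIndex_left k (pos_iff_ne_zero.2 ht)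
      exact ⟨n, hn⟩

/-- One step of the reflected dynamics: the configuration `y` is moved by `d`, level by level,
and every coordinate is projected on the interval formed by its neighbours. -/
noncomputable def reflectStep {N : ℕ} (y d : Particle N → ℝ) (v : Particle N) : ℝ :=
  if h : 1 < v.idx then
    max (reflectStep y d (v.lower h))
      (if h' : v.idx < v.level then min (y v + d v) (reflectStep y d (v.upper h')) else y v + d v)
  else
    (if h' : v.idx < v.level then min (y v + d v) (reflectStep y d (v.upper h')) else y v + d v)
termination_by v.level
decreasing_by
  all_goals first
    | exact v.level_lower_lt h
    | exact v.level_upper_lt h'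

theorem reflectStep_lower_le {N : ℕ} (y d : Particle N → ℝ) (v : Particle N) (h : 1 < v.idx) :
    reflectStep y d (v.lower h) ≤ reflectStep y d v := by
  conv_rhs => rw [reflectStep, dif_pos h]
  exact le_max_left _ _

theorem isInterlaced_reflectStep {N : ℕ} (y d : Particle N → ℝ) :
    IsInterlaced (reflectStep y d) := by
  intro v
  induction v using Particle.level_induction with
  | h v hl hu =>
    refine ⟨reflectStep_lower_le y d v, fun h' => ?_⟩
    conv_lhs => rw [reflectStep]
    rw [dif_pos h']
    split_ifs with h
    · refine max_le ?_ (min_le_right _ _)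
      -- The two neighbours of `v` share a neighbour two levels below `v`, which separates them;
      -- hence the barriers are ordered and the outer `max` does not break the upper constraint.
      have h1 : (v.lower h).idx < (v.lower h).level := by simp only [Particle.lower]; omega
      exact ((hl h).2 h1).trans ((hu h').1 h)
    · exact min_le_right _ _

/-- Projection lowers a coordinate only by placing it on its upper barrier. This and
`reflectStep_le` are the jump conditions behind `push_up` and `push_down`. -/
theorem le_reflectStep {N : ℕ} (y d : Particle N → ℝ) (v : Particle N)
    (h : ¬ ∃ h : v.idx < v.level, reflectStep y d v = reflectStep y d (v.upper h)) :
    y v + d v ≤ reflectStep y d v := by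
  by_contra! hlt
  refine h ?_
  have hlt' := hlt
  rw [reflectStep] at hlt
  by_cases h' : v.idx < v.level
  · refine ⟨h', le_antisymm ((isInterlaced_reflectStep y d v).2 h') ?_⟩
    simp only [dif_pos h'] at hlt
    have h1 : min (y v + d v) (reflectStep y d (v.upper h')) < y v + d v := by
      split_ifs at hlt
      · exact (le_max_right _ _).trans_lt hlt
      · exact hlt
    have h2 : reflectStep y d (v.upper h') < y v + d v := by
      by_contra! hcon
      rw [min_eq_left hcon] at h1
      exact lt_irrefl _ h1
    rw [min_eq_right h2.le] at hlt
    conv_rhs => rw [reflectStep]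
    rw [dif_pos h', min_eq_right h2.le]
    split_ifs
    · exact le_max_right _ _
    · exact le_rfl
  · simp only [dif_neg h'] at hlt
    split_ifs at hlt
    · exact absurd ((le_max_right _ _).trans_lt hlt) (lt_irrefl _)
    · exact absurd hlt (lt_irrefl _)

theorem reflectStep_le {N : ℕ} (y d : Particle N → ℝ) (v : Particle N)
    (h : ¬ ∃ h : 1 < v.idx, reflectStep y d (v.lower h) = reflectStep y d v) :
    reflectStep y d v ≤ y v + d v := by
  have key : (if h' : v.idx < v.level then min (y v + d v) (reflectStep y d (v.upper h'))
      else y v + d v) ≤ y v + d v := by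
    split_ifs
    · exact min_le_left _ _
    · exact le_rfl
  by_cases h1 : 1 < v.idx
  · have h2 : reflectStep y d (v.lower h1) < reflectStep y d v :=
      lt_of_le_of_ne (reflectStep_lower_le y d v h1) fun he => h ⟨h1, he⟩
    have h3 : reflectStep y d v = max (reflectStep y d (v.lower h1)) (if h' : v.idx < v.level then
        min (y v + d v) (reflectStep y d (v.upper h')) else y v + d v) := by
      conv_lhs => rw [reflectStep, dif_pos h1]
    rcases max_choice (reflectStep y d (v.lower h1)) (if h' : v.idx < v.level then
      min (y v + d v) (reflectStep y d (v.upper h')) else y v + d v) with h4 | h4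
    · rw [h3, h4] at h2
      exact absurd h2 (lt_irrefl _)
    · rw [h3, h4]
      exact key
  · rw [reflectStep, dif_neg h1]
    exact key

theorem continuous_reflectStep {N : ℕ} :
    Continuous fun p : (Particle N → ℝ) × (Particle N → ℝ) => reflectStep p.1 p.2 := by
  refine continuous_pi fun v => ?_
  induction v using Particle.level_induction with
  | h v hl hu =>
    simp_rw [reflectStep.eq_def _ _ v]
    have h0 : Continuous fun p : (Particle N → ℝ) × (Particle N → ℝ) => p.1 v + p.2 v := by
      fun_prop
    by_cases h : 1 < v.idx <;> by_cases h' : v.idx < v.level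
    · simp only [dif_pos h, dif_pos h']
      exact (hl h).max (h0.min (hu h'))
    · simp only [dif_pos h, dif_neg h']
      exact (hl h).max h0
    · simp only [dif_neg h, dif_pos h']
      exact h0.min (hu h')
    · simp only [dif_neg h, dif_neg h']
      exact h0

/-- By induction the barriers move by at most `ε`, and `y v` lay between the old ones, so clamping
to the new ones keeps the bound. Without `hy` the projection could make a large correction. -/
theorem abs_reflectStep_sub_le {N : ℕ} {y d : Particle N → ℝ} (hy : IsInterlaced y) {ε : ℝ}
    (hd : ∀ v, |d v| ≤ ε) (v : Particle N) : |reflectStep y d v - y v| ≤ ε := by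
  induction v using Particle.level_induction with
  | h v hl hu =>
    have h0 := abs_le.1 (hd v)
    have h1 : -ε ≤ (if h' : v.idx < v.level then min (y v + d v) (reflectStep y d (v.upper h'))
        else y v + d v) - y v ∧ (if h' : v.idx < v.level then
        min (y v + d v) (reflectStep y d (v.upper h')) else y v + d v) - y v ≤ ε := by
      split_ifs with h'
      · have h2 := abs_le.1 (hu h')
        have h3 := (hy v).2 h'
        constructor
        · rw [le_sub_iff_add_le]
          exact le_min (by linarith) (by linarith)
        · have := min_le_left (y v + d v) (reflectStep y d (v.upper h'))
          linarith
      · constructor <;> linarith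
    rw [reflectStep, abs_le]
    by_cases h : 1 < v.idx
    · rw [dif_pos h]
      have h2 := abs_le.1 (hl h)
      have h3 := (hy v).1 h
      constructor
      · have := le_max_right (reflectStep y d (v.lower h)) (if h' : v.idx < v.level then
          min (y v + d v) (reflectStep y d (v.upper h')) else y v + d v)
        linarith
      · rw [sub_le_iff_le_add]
        exact max_le (by linarith) (by linarith)
    · rw [dif_neg h]
      exact h1

/-- The reflected dynamics in discrete time, started at `y` and driven by the sequence `z`. -/
noncomputable def reflectScheme {N : ℕ} (y : Particle N → ℝ) (z : ℕ → Particle N → ℝ) : ℕ → Particle N → ℝ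
  | 0 => y
  | j + 1 => reflectStep (reflectScheme y z j) (z (j + 1) - z j)

theorem isInterlaced_reflectScheme {N : ℕ} {y : Particle N → ℝ} (hy : IsInterlaced y)
    (z : ℕ → Particle N → ℝ) (j : ℕ) : IsInterlaced (reflectScheme y z j) := by
  cases j with
  | zero => exact hy
  | succ j => exact isInterlaced_reflectStep _ _

theorem continuous_reflectScheme {N : ℕ} (j : ℕ) :
    Continuous fun p : (Particle N → ℝ) × (ℕ → Particle N → ℝ) => reflectScheme p.1 p.2 j := by
  induction j with
  | zero => exact continuous_fst
  | succ j ih =>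
    have h : Continuous fun p : (Particle N → ℝ) × (ℕ → Particle N → ℝ) => p.2 (j + 1) - p.2 j := by
      fun_prop
    exact continuous_reflectStep.comp (ih.prodMk h)

/-- The path of the discretized reflected dynamics with mesh `1 / (k + 1)`. -/
noncomputable def gridPath {N : ℕ} (k : ℕ) (p : (Particle N → ℝ) × (ℕ → Particle N → ℝ)) :
    CadlagPath (Particle N → ℝ) where
  toFun t := reflectScheme p.1 p.2 (gridIndex k t)
  cadlag := ((isStepFunction_gridIndex k).comp _).isCadlag

/-- The possible jump times are deterministic, so on `[0, T]` uniform closeness involves only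
finitely many values of the scheme. -/
theorem continuous_gridPath {N : ℕ} (k : ℕ) : Continuous (gridPath (N := N) k) := by
  refine continuous_iff_continuousAt.2 fun p => CadlagPath.tendsto_nhds fun T ε hε => ?_
  have h : ∀ᶠ q in 𝓝 p, ∀ j ∈ Finset.range (gridIndex k T + 1), ∀ v,
      |reflectScheme p.1 p.2 j v - reflectScheme q.1 q.2 j v| < ε := by
    rw [Filter.eventually_all_finset]
    intro j _
    rw [Filter.eventually_all]
    intro v
    have h1 : Continuous fun q : (Particle N → ℝ) × (ℕ → Particle N → ℝ) =>
      reflectScheme q.1 q.2 j v := (continuous_apply v).comp (continuous_reflectScheme j)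
    filter_upwards [Metric.tendsto_nhds.1 (h1.tendsto p) ε hε] with q hq
    rwa [dist_comm] at hq
  filter_upwards [h] with q hq t ht v
  exact hq _ (Finset.mem_range.2 (Nat.lt_succ_of_le (gridIndex_mono k ht))) v

/-- The discretized dynamics is a reflection of the discretized driving path. -/
theorem isReflectedSystem_gridPath {N : ℕ} (k : ℕ) {y : Particle N → ℝ} (hy : IsInterlaced y)
    {z : ℕ → Particle N → ℝ} (hz : z 0 = 0) :
    IsReflectedSystem 0 (fun t v => y v + z (gridIndex k t) v) (gridPath k (y, z)) := by
  have hstep : ∀ f : ℕ → ℝ, IsStepFunction fun t => f (gridIndex k t) :=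
    (isStepFunction_gridIndex k).comp
  have hjump : ∀ (f : ℕ → ℝ) (U : ℕ → Prop), (∀ n, ¬ U (n + 1) → f n ≤ f (n + 1)) →
      NondecreasingOff (fun t => f (gridIndex k t)) (fun t => U (gridIndex k t)) := by
    intro f U hf
    refine (hstep f).nondecreasingOff fun t ht hU c hc => ?_
    obtain ⟨n, hn1, hn2⟩ := eventually_gridIndex_left k ht
    have := NNReal.nhdsLT_neBot ht
    obtain ⟨s, hs1, hs2⟩ := (hc.and hn1).exists
    rw [hs2] at hs1
    rcases hn2 with h | h
    · rw [h, hs1]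
    · rw [h] at hU ⊢
      exact hs1 ▸ hf n hU
  refine ⟨fun v t => ?_, fun v => ?_, fun t v h => ?_, fun t v h => ?_, fun v => ?_, fun v => ?_⟩
  · obtain ⟨c, hc⟩ := (hstep fun n => reflectScheme y z n v - (y v + z n v)).left t
    exact ⟨c, tendsto_const_nhds.congr' (hc.mono fun s hs => hs.symm)⟩
  · simp [gridPath, gridIndex_zero, reflectScheme, hz]
  · exact (isInterlaced_reflectScheme hy z _ v).1 h
  · rw [add_zero]
    exact (isInterlaced_reflectScheme hy z _ v).2 h
  · refine hjump (fun n => reflectScheme y z n v - (y v + z n v))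
      (fun n => ∃ h : v.idx < v.level, reflectScheme y z n v + 0 = reflectScheme y z n (v.upper h))
      fun n hU => ?_
    simp only [add_zero] at hU
    have := le_reflectStep (reflectScheme y z n) (z (n + 1) - z n) v hU
    simp only [Pi.sub_apply] at this
    simp only [reflectScheme]
    linarith
  · refine hjump (fun n => -(reflectScheme y z n v - (y v + z n v)))
      (fun n => ∃ h : 1 < v.idx, reflectScheme y z n (v.lower h) = reflectScheme y z n v)
      fun n hU => ?_
    have := reflectStep_le (reflectScheme y z n) (z (n + 1) - z n) v hU
    simp only [Pi.sub_apply] at this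
    simp only [reflectScheme]
    linarith

/-! ### Existence of the reflected system driven by a continuous path -/

theorem dist_gridPoint_lt (k : ℕ) (t : ℝ≥0) :
    dist t (gridPoint k (gridIndex k t)) < gridPoint k 1 := by
  have h1 := lt_gridPoint_succ k t
  rw [gridPoint_succ] at h1
  have h2 := gridPoint_le k t
  rw [NNReal.dist_eq, abs_of_nonneg (sub_nonneg.2 (by exact_mod_cast h2)), sub_lt_iff_lt_add']
  exact_mod_cast h1

theorem tendsto_gridPoint_one : Tendsto (fun k => ((gridPoint k 1 : ℝ≥0) : ℝ)) atTop (𝓝 0) := by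
  have h := tendsto_one_div_add_atTop_nhds_zero_nat (𝕜 := ℝ)
  simpa [gridPoint] using h

theorem exists_modulus {N : ℕ} {u : ℝ≥0 → Particle N → ℝ} (hu : Continuous u) (T : ℝ≥0) {ε : ℝ}
    (hε : 0 < ε) : ∃ δ > 0, ∀ s ≤ T, ∀ t ≤ T, dist s t < δ → ∀ v, |u s v - u t v| < ε := by
  let := Fintype.ofFinite (Particle N)
  have h := (isCompact_Icc (a := (0 : ℝ≥0)) (b := T)).uniformContinuousOn_of_continuous
    hu.continuousOn
  obtain ⟨δ, hδ, h⟩ := Metric.uniformContinuousOn_iff.1 h ε hε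
  exact ⟨δ, hδ, fun s hs t ht hst v => (dist_pi_lt_iff hε).1
    (h s ⟨zero_le, hs⟩ t ⟨zero_le, ht⟩ hst) v⟩

theorem eventually_abs_sub_gridPoint_lt {N : ℕ} {u : ℝ≥0 → Particle N → ℝ} (hu : Continuous u)
    (T : ℝ≥0) {ε : ℝ} (hε : 0 < ε) :
    ∀ᶠ k in atTop, ∀ t ≤ T, ∀ v, |u t v - u (gridPoint k (gridIndex k t)) v| < ε := by
  obtain ⟨δ, hδ, h⟩ := exists_modulus hu T hε
  filter_upwards [tendsto_gridPoint_one.eventually (gt_mem_nhds hδ)] with k hk t ht v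
  exact h t ht _ ((gridPoint_le k t).trans ht) ((dist_gridPoint_lt k t).trans hk) v

theorem gridIndex_eq_or_eq_succ {k : ℕ} {s t : ℝ≥0} (hst : s ≤ t) (h : t < s + gridPoint k 1) :
    gridIndex k t = gridIndex k s ∨ gridIndex k t = gridIndex k s + 1 := by
  have h1 : gridIndex k s ≤ gridIndex k t := gridIndex_mono k hst
  have h2 : gridIndex k t < gridIndex k s + 2 := by
    rw [← (gridPoint_strictMono k).lt_iff_lt]
    refine (gridPoint_le k t).trans_lt (h.trans ?_)
    rw [gridPoint_succ k (gridIndex k s + 1)]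
    gcongr
    exact lt_gridPoint_succ k s
  omega

/-- Times less than one mesh apart differ by at most one step of the scheme. This is the
equicontinuity that makes the limit of the discontinuous grid paths continuous. -/
theorem abs_gridPath_sub_le {N : ℕ} {u : ℝ≥0 → Particle N → ℝ} {y : Particle N → ℝ}
    (hy : IsInterlaced y) {k : ℕ} {T : ℝ≥0} {ε : ℝ} (hε : 0 ≤ ε)
    (hu : ∀ j, gridPoint k (j + 1) ≤ T → ∀ v,
      |u (gridPoint k (j + 1)) v - u (gridPoint k j) v| ≤ ε)
    {s t : ℝ≥0} (hst : s ≤ t) (htT : t ≤ T) (h : t < s + gridPoint k 1) (v : Particle N) :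
    |gridPath k (y, fun j => u (gridPoint k j)) t v -
      gridPath k (y, fun j => u (gridPoint k j)) s v| ≤ ε := by
  simp only [gridPath]
  rcases gridIndex_eq_or_eq_succ hst h with h1 | h1
  · rw [h1, sub_self, abs_zero]
    exact hε
  · have h2 := (gridPoint_le k t).trans htT
    rw [h1] at h2 ⊢
    exact abs_reflectStep_sub_le (isInterlaced_reflectScheme hy _ _) (hu _ h2) v

theorem NondecreasingOff.of_tendsto {η : ℕ → ℝ≥0 → ℝ} {ζ : ℝ≥0 → ℝ} {V : ℕ → ℝ≥0 → Prop}
    {U : ℝ≥0 → Prop} (h : ∀ k, NondecreasingOff (η k) (V k)) (hζ : Continuous ζ)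
    (hlim : ∀ t, Tendsto (fun k => η k t) atTop (𝓝 (ζ t)))
    (hU : ∀ s t, (∀ u ∈ Set.Icc s t, ¬ U u) → ∀ᶠ k in atTop, ∀ u ∈ Set.Icc s t, ¬ V k u) :
    NondecreasingOff ζ U where
  le s t hst hs := by
    rcases hst.eq_or_lt with rfl | hlt
    · exact le_rfl
    -- `hU` requires `U` to fail on a closed interval, but it may hold at `s`; so start at `r > s`
    -- and let `r` decrease to `s`.
    have key : ∀ r ∈ Set.Ioo s t, ζ r ≤ ζ t := by
      intro r hr
      refine le_of_tendsto_of_tendsto (hlim r) (hlim t) ?_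
      filter_upwards [hU r t fun u hu => hs u ⟨hr.1.trans_le hu.1, hu.2⟩] with k hk
      exact (h k).le r t hr.2.le fun u hu => hk u ⟨hu.1.le, hu.2⟩
    have : (𝓝[>] s).NeBot := nhdsGT_neBot_of_exists_gt ⟨t, hlt⟩
    refine le_of_tendsto ((hζ.tendsto s).mono_left nhdsWithin_le_nhds : Tendsto ζ (𝓝[>] s) _) ?_
    filter_upwards [Ioo_mem_nhdsGT hlt] with r hr using key r hr
  left_le t ht _ c hc := by
    have := NNReal.nhdsLT_neBot ht
    exact (tendsto_nhds_unique hc ((hζ.tendsto t).mono_left nhdsWithin_le_nhds)).le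

/-- The grid paths are reflected systems whose drivers converge uniformly on compacts, so the
Lipschitz bound makes them Cauchy. The limit inherits the reflection conditions because contact with
a barrier is stable under uniform limits (`hgap`). -/
theorem exists_reflectedSystem {N : ℕ} {u : ℝ≥0 → Particle N → ℝ} (hu : Continuous u)
    (hu0 : u 0 = 0) {y : Particle N → ℝ} (hy : IsInterlaced y) :
    ∃ w : ℝ≥0 → Particle N → ℝ, Continuous w ∧
      (∀ t v, Tendsto (fun k => gridPath k (y, fun j => u (gridPoint k j)) t v) atTop
        (𝓝 (w t v))) ∧
      IsReflectedSystem 0 (fun t v => y v + u t v) w := by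
  set S : ℕ → CadlagPath (Particle N → ℝ) := fun k => gridPath k (y, fun j => u (gridPoint k j))
    with hS
  have hrefl : ∀ k, IsReflectedSystem 0
      (fun t v => y v + u (gridPoint k (gridIndex k t)) v) (S k) := fun k =>
    isReflectedSystem_gridPath k hy (z := fun j => u (gridPoint k j)) (by rw [gridPoint_zero, hu0])
  have hcauchy : ∀ T : ℝ≥0, ∀ ε > 0, ∃ K, ∀ k ≥ K, ∀ l ≥ K, ∀ t ≤ T, ∀ v,
      |S k t v - S l t v| < ε := by
    intro T ε hε
    obtain ⟨δ, hδ, hδε⟩ : ∃ δ > 0, 3 * N * δ < ε := by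
      refine ⟨ε / (3 * N + 1), by positivity, ?_⟩
      rw [mul_div_assoc', div_lt_iff₀ (by positivity)]
      linarith
    -- Each frozen driver is within `δ / 2` of `u`, hence any two of them are within `δ`.
    obtain ⟨K, hK⟩ := eventually_atTop.1 (eventually_abs_sub_gridPoint_lt hu T (half_pos hδ))
    refine ⟨K, fun k hk l hl t ht v => lt_of_le_of_lt ?_ hδε⟩
    refine (hrefl k).abs_sub_le (hrefl l) hδ.le (by simpa using hδ.le) (fun t ht v => ?_) t ht v
    have h1 := abs_lt.1 (hK k hk t ht v)
    have h2 := abs_lt.1 (hK l hl t ht v)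
    rw [abs_le]
    constructor <;> linarith
  have hex : ∀ t v, ∃ a, Tendsto (fun k => S k t v) atTop (𝓝 a) := by
    intro t v
    refine cauchySeq_tendsto_of_complete (Metric.cauchySeq_iff.2 fun ε hε => ?_)
    obtain ⟨K, hK⟩ := hcauchy t ε hε
    exact ⟨K, fun k hk l hl => hK k hk l hl t le_rfl v⟩
  choose w hw using hex
  have hunif : ∀ T : ℝ≥0, ∀ ε > 0, ∃ K, ∀ k ≥ K, ∀ t ≤ T, ∀ v, |S k t v - w t v| ≤ ε := by
    intro T ε hε
    obtain ⟨K, hK⟩ := hcauchy T ε hε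
    refine ⟨K, fun k hk t ht v => ?_⟩
    refine le_of_tendsto ((tendsto_const_nhds (x := S k t v)).sub (hw t v)).abs ?_
    filter_upwards [eventually_ge_atTop K] with l hl
    exact (hK k hk l hl t ht v).le
  have hcont : Continuous w := by
    refine continuous_pi fun v => continuous_iff_continuousAt.2 fun t => ?_
    refine Metric.tendsto_nhds.2 fun ε hε => ?_
    have hε4 : 0 < ε / 4 := by positivity
    obtain ⟨K, hK⟩ := hunif (t + 1) (ε / 4) hε4
    obtain ⟨δ, hδ, hmod⟩ := exists_modulus hu (t + 1) hε4
    obtain ⟨k, hk1, hk2⟩ := ((tendsto_gridPoint_one.eventually (gt_mem_nhds hδ)).and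
      (eventually_ge_atTop K)).exists
    have hstep : ∀ j, gridPoint k (j + 1) ≤ t + 1 → ∀ v,
        |u (gridPoint k (j + 1)) v - u (gridPoint k j) v| ≤ ε / 4 := by
      intro j hj v
      refine (hmod _ hj _ (((gridPoint_strictMono k) j.lt_succ_self).le.trans hj) ?_ v).le
      rw [gridPoint_succ, NNReal.dist_eq]
      simpa using hk1
    have hpos : (0 : ℝ) < min (gridPoint k 1 : ℝ≥0) 1 := by
      refine lt_min ?_ one_pos
      have := gridPoint_strictMono k zero_lt_one
      rw [gridPoint_zero] at this
      exact_mod_cast this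
    filter_upwards [Metric.ball_mem_nhds t hpos] with s hs
    rw [Metric.mem_ball, NNReal.dist_eq, abs_lt, NNReal.coe_min, NNReal.coe_one] at hs
    have hm1 := min_le_left ((gridPoint k 1 : ℝ≥0) : ℝ) 1
    have hm2 := min_le_right ((gridPoint k 1 : ℝ≥0) : ℝ) 1
    have hs1 : s ≤ t + 1 := by
      rw [← NNReal.coe_le_coe]; push_cast; linarith
    have ht1 : t ≤ t + 1 := le_self_add
    have h1 : |S k s v - S k t v| ≤ ε / 4 := by
      rcases le_total s t with hst | hst
      · rw [abs_sub_comm]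
        refine abs_gridPath_sub_le hy hε4.le hstep hst ht1 ?_ v
        rw [← NNReal.coe_lt_coe]; push_cast; linarith
      · refine abs_gridPath_sub_le hy hε4.le hstep hst hs1 ?_ v
        rw [← NNReal.coe_lt_coe]; push_cast; linarith
    have h2 := hK k hk2 s hs1 v
    have h3 := hK k hk2 t ht1 v
    rw [Real.dist_eq, abs_lt]
    rw [abs_le] at h1 h2 h3
    constructor <;> linarith
  have hlimu : ∀ t v, Tendsto (fun k => u (gridPoint k (gridIndex k t)) v) atTop (𝓝 (u t v)) := by
    intro t v
    refine Metric.tendsto_nhds.2 fun ε hε => ?_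
    filter_upwards [eventually_abs_sub_gridPoint_lt hu t hε] with k hk
    rw [dist_comm]
    exact hk t le_rfl v
  have hlimη : ∀ t v, Tendsto (fun k => S k t v - (y v + u (gridPoint k (gridIndex k t)) v)) atTop
      (𝓝 (w t v - (y v + u t v))) := fun t v =>
    (hw t v).sub ((hlimu t v).const_add _)
  have hcontη : ∀ v, Continuous fun t => w t v - (y v + u t v) := fun v => by fun_prop
  have hgap : ∀ a b : Particle N, ∀ s t : ℝ≥0, (∀ r ∈ Set.Icc s t, w r a ≠ w r b) →
      ∀ᶠ k in atTop, ∀ r ∈ Set.Icc s t, S k r a ≠ S k r b := by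
    intro a b s t h
    rcases (Set.Icc s t).eq_empty_or_nonempty with he | hne
    · simp [he]
    have hc : Continuous fun r => |w r a - w r b| := by fun_prop
    -- On a compact interval the distance of two limit paths that never meet has a positive minimum;
    -- approximations within a third of it cannot meet either.
    obtain ⟨r₀, hr₀, hmin⟩ := isCompact_Icc.exists_isMinOn hne hc.continuousOn
    have hpos : 0 < |w r₀ a - w r₀ b| := abs_pos.2 (sub_ne_zero.2 (h r₀ hr₀))
    obtain ⟨K, hK⟩ := hunif t (|w r₀ a - w r₀ b| / 3) (by positivity)
    filter_upwards [eventually_ge_atTop K] with k hk r hr heq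
    have h1 := hK k hk r hr.2 a
    have h2 := hK k hk r hr.2 b
    have h3 : |w r₀ a - w r₀ b| ≤ |w r a - w r b| := hmin hr
    have h4 : |w r a - w r b| ≤ |S k r a - w r a| + |S k r b - w r b| := by
      rw [heq, show w r a - w r b = (S k r b - w r b) - (S k r b - w r a) by ring, add_comm]
      exact abs_sub _ _
    linarith
  refine ⟨w, hcont, hw, fun v t => ⟨_, ((hcontη v).tendsto t).mono_left nhdsWithin_le_nhds⟩,
    fun v => ?_, fun t v h => ?_, fun t v h => ?_, fun v => ?_, fun v => ?_⟩
  · refine tendsto_nhds_unique (hw 0 v) ?_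
    simp only [(hrefl _).zero, gridIndex_zero, gridPoint_zero]
    exact tendsto_const_nhds
  · exact le_of_tendsto_of_tendsto' (hw t _) (hw t v) fun k => (hrefl k).lower_le t v h
  · rw [add_zero]
    refine le_of_tendsto_of_tendsto' (hw t v) (hw t _) fun k => ?_
    simpa using (hrefl k).le_upper t v h
  · refine NondecreasingOff.of_tendsto (fun k => (hrefl k).push_up v) (hcontη v)
      (fun t => hlimη t v) fun s t hU => ?_
    by_cases h : v.idx < v.level
    · simp only [h, exists_true_left, add_zero] at hU ⊢
      exact hgap _ _ s t hU
    · simp [h]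
  · refine NondecreasingOff.of_tendsto (fun k => (hrefl k).push_down v) (hcontη v).neg
      (fun t => (hlimη t v).neg) fun s t hU => ?_
    by_cases h : 1 < v.idx
    · simp only [h, exists_true_left] at hU ⊢
      exact hgap _ _ s t hU
    · simp [h]

/-! ### Comparison with the reflections in extended intervals -/

theorem lt_rightBarrier_iff {N : ℕ} {w : ℝ≥0 → Particle N → ℝ} {v : Particle N} {t : ℝ≥0}
    {x : ℝ} : (x : EReal) < rightBarrier w v t ↔ ∀ h : v.idx < v.level, x < w t (v.upper h) := by
  unfold rightBarrier
  by_cases h : v.idx < v.level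
  · simp [h]
  · simp [h, EReal.coe_lt_top]

theorem le_rightBarrier_iff {N : ℕ} {w : ℝ≥0 → Particle N → ℝ} {v : Particle N} {t : ℝ≥0}
    {x : ℝ} : (x : EReal) ≤ rightBarrier w v t ↔ ∀ h : v.idx < v.level, x ≤ w t (v.upper h) := by
  unfold rightBarrier
  by_cases h : v.idx < v.level
  · simp [h]
  · simp [h]

theorem leftBarrier_lt_iff {N : ℕ} {w : ℝ≥0 → Particle N → ℝ} {v : Particle N} {t : ℝ≥0}
    {x : ℝ} : leftBarrier w v t < (x : EReal) ↔ ∀ h : 1 < v.idx, w t (v.lower h) < x := by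
  unfold leftBarrier
  by_cases h : 1 < v.idx
  · simp [h]
  · simp [h, EReal.bot_lt_coe]

theorem leftBarrier_le_iff {N : ℕ} {w : ℝ≥0 → Particle N → ℝ} {v : Particle N} {t : ℝ≥0}
    {x : ℝ} : leftBarrier w v t ≤ (x : EReal) ↔ ∀ h : 1 < v.idx, w t (v.lower h) ≤ x := by
  unfold leftBarrier
  by_cases h : 1 < v.idx
  · simp [h]
  · simp [h]

theorem not_exists_eq_upper {N : ℕ} {w : ℝ≥0 → Particle N → ℝ}
    {v : Particle N} {t : ℝ≥0}
    (h : (w t v : EReal) < rightBarrier w v t) :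
    ¬ ∃ h : v.idx < v.level, w t v + 0 = w t (v.upper h) := by
  rintro ⟨h', he⟩
  have := lt_rightBarrier_iff.1 h h'
  linarith

theorem not_exists_eq_lower {N : ℕ} {w : ℝ≥0 → Particle N → ℝ}
    {v : Particle N} {t : ℝ≥0} (h : leftBarrier w v t < (w t v : EReal)) :
    ¬ ∃ h : 1 < v.idx, w t (v.lower h) = w t v := by
  rintro ⟨h', he⟩
  have := leftBarrier_lt_iff.1 h h'
  linarith

theorem IsReflectedSystem.isReflection {N : ℕ} {ψ w : ℝ≥0 → Particle N → ℝ}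
    (hw : IsReflectedSystem 0 ψ w) (hψc : Continuous ψ) (hwc : Continuous w) (v : Particle N) :
    IsReflection (leftBarrier w v) (rightBarrier w v) (fun t => ψ t v) (fun t => w t v) := by
  have hlim : ∀ t, 0 < t → Function.leftLim (fun s => w s v - ψ s v) t = w t v - ψ t v := by
    intro t ht
    have := NNReal.nhdsLT_neBot ht
    have hc : Continuous fun s => w s v - ψ s v := by fun_prop
    exact leftLim_eq_of_tendsto ((hc.tendsto t).mono_left nhdsWithin_le_nhds)
  refine ⟨fun t => leftBarrier_le_iff.2 (hw.lower_le t v), fun t => le_rightBarrier_iff.2 fun h => ?_,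
    fun s t hst h => ?_, fun s t hst h => ?_, fun t ht _ => (hlim t ht).le,
    fun t ht _ => (hlim t ht).ge, fun _ => ?_, fun _ => ?_⟩
  · simpa using hw.le_upper t v h
  · exact (hw.push_up v).le s t hst fun u hu => not_exists_eq_upper (h u hu)
  · exact neg_le_neg_iff.1 ((hw.push_down v).le s t hst fun u hu =>
      not_exists_eq_lower (h u hu))
  · simp [hw.zero]
  · simp [hw.zero]

/-- This applies the Lipschitz bound to an arbitrary realization of `W`, which is known only to be
càdlàg; the jump conditions of `IsReflection` replace continuity. -/
theorem isReflectedSystem_of_isReflection {N : ℕ} {ψ : ℝ≥0 → Particle N → ℝ}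
    {w : CadlagPath (Particle N → ℝ)} (hψ : Continuous ψ) (h0 : ∀ v, w 0 v = ψ 0 v)
    (h : ∀ v, IsReflection (leftBarrier w v) (rightBarrier w v) (fun t => ψ t v) fun t => w t v) :
    IsReflectedSystem 0 ψ w := by
  have hlim : ∀ v t, ∃ a, Tendsto (fun s => w s v - ψ s v) (𝓝[<] t) (𝓝 a) := by
    intro v t
    obtain ⟨c, hc⟩ := (w.cadlag t).2
    exact ⟨_, (tendsto_pi_nhds.1 hc v).sub ((((continuous_apply v).comp hψ).tendsto t).mono_left
      nhdsWithin_le_nhds)⟩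
  have hup : ∀ v t, ¬ (∃ h : v.idx < v.level, w t v + 0 = w t (v.upper h)) →
      (w t v : EReal) < rightBarrier w v t := fun v t hn => lt_rightBarrier_iff.2 fun h' =>
    lt_of_le_of_ne (le_rightBarrier_iff.1 ((h v).le_upper t) h') fun he => hn ⟨h', by simpa using he⟩
  have hlow : ∀ v t, ¬ (∃ h : 1 < v.idx, w t (v.lower h) = w t v) →
      leftBarrier w v t < (w t v : EReal) := fun v t hn => leftBarrier_lt_iff.2 fun h' =>
    lt_of_le_of_ne (leftBarrier_le_iff.1 ((h v).lower_le t) h') fun he => hn ⟨h', he⟩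
  have hleft : ∀ v t, 0 < t → ∀ c, Tendsto (fun s => w s v - ψ s v) (𝓝[<] t) (𝓝 c) →
      Function.leftLim (fun s => w s v - ψ s v) t = c := fun v t ht c hc =>
    have := NNReal.nhdsLT_neBot ht
    leftLim_eq_of_tendsto hc
  refine ⟨hlim, h0, fun t v => leftBarrier_le_iff.1 ((h v).lower_le t), fun t v h' => ?_,
    fun v => ⟨fun s t hst hU => ?_, fun t ht hU c hc => ?_⟩,
    fun v => ⟨fun s t hst hU => ?_, fun t ht hU c hc => ?_⟩⟩
  · rw [add_zero]
    exact le_rightBarrier_iff.1 ((h v).le_upper t) h'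
  · exact (h v).mono s t hst fun u hu => hup v u (hU u hu)
  · rw [← hleft v t ht c hc]
    exact (h v).jump_nonneg t ht (hup v t hU)
  · exact neg_le_neg ((h v).anti s t hst fun u hu => hlow v u (hU u hu))
  · have hc' : Tendsto (fun s => w s v - ψ s v) (𝓝[<] t) (𝓝 (-c)) := by simpa using hc.neg
    rw [le_neg, ← hleft v t ht (-c) hc']
    exact (h v).jump_nonpos t ht (hlow v t hU)

/-! ### The interlacing dynamics on integer arrays -/

theorem IsSequentialUpdate.unique {N : ℕ} {y d z z' : Particle N → ℤ}
    (h : IsSequentialUpdate y d z) (h' : IsSequentialUpdate y d z') : z = z' := by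
  funext v
  induction v using Particle.level_induction with
  | h v hl hu =>
    rw [h v, h' v]
    simp only [hl, hu]

theorem isSequentialUpdate_zero {N : ℕ} {y : Particle N → ℤ} (hy : IsGelfandTsetlin y) :
    IsSequentialUpdate y 0 y := by
  intro v
  rw [if_neg, if_neg]
  · simp
  · rintro ⟨h, he⟩
    have := (hy v).2 h
    omega
  · rintro ⟨h, he⟩
    have := (hy v).1 h
    omega

/-- The claims need each other one level down: unit moves of the neighbours ensure that a push by
one suffices, and their common neighbour keeps them strictly apart, so the particle has room. -/
theorem IsSequentialUpdate.abs_sub_le_and {N : ℕ} {y d z : Particle N → ℤ}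
    (h : IsSequentialUpdate y d z) (hy : IsGelfandTsetlin y) (v : Particle N) :
    |z v - y v| ≤ 1 ∧ (∀ h : 1 < v.idx, z (v.lower h) ≤ z v) ∧
      (∀ h : v.idx < v.level, z v < z (v.upper h)) := by
  induction v using Particle.level_induction with
  | h v hl hu =>
    have hz := h v
    by_cases h1 : 1 < v.idx <;> by_cases h2 : v.idx < v.level
    · have e1 : (v.lower h1).idx < (v.lower h1).level := by simp only [Particle.lower]; omega
      have g1 := (hl h1).2.2 e1
      have g2 : z ((v.lower h1).upper e1) ≤ z (v.upper h2) := (hu h2).2.1 h1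
      have g3 := abs_le.1 (hl h1).1
      have g4 := abs_le.1 (hu h2).1
      have g5 := (hy v).1 h1
      have g6 := (hy v).2 h2
      simp only [h1, h2, exists_true_left, forall_true_left, abs_le] at hz ⊢
      split_ifs at hz <;> omega
    · have g3 := abs_le.1 (hl h1).1
      have g5 := (hy v).1 h1
      simp only [h1, h2, exists_true_left, IsEmpty.exists_iff, if_false] at hz
      refine ⟨abs_le.2 ⟨?_, ?_⟩, fun _ => ?_, fun h => absurd h h2⟩ <;>
      · split_ifs at hz <;> omega
    · have g4 := abs_le.1 (hu h2).1
      have g6 := (hy v).2 h2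
      simp only [h1, h2, exists_true_left, IsEmpty.exists_iff, if_false] at hz
      refine ⟨abs_le.2 ⟨?_, ?_⟩, fun h => absurd h h1, fun _ => ?_⟩ <;>
      · split_ifs at hz <;> omega
    · simp only [h1, h2, IsEmpty.exists_iff, if_false] at hz
      refine ⟨abs_le.2 ⟨?_, ?_⟩, fun h => absurd h h1, fun h => absurd h h2⟩ <;>
      · split_ifs at hz <;> omega

theorem IsSequentialUpdate.isGelfandTsetlin {N : ℕ} {y d z : Particle N → ℤ}
    (h : IsSequentialUpdate y d z) (hy : IsGelfandTsetlin y) : IsGelfandTsetlin z :=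
  fun v => (h.abs_sub_le_and hy v).2

/-- A particle falls short of its driver only when pushed down by rule (2) or blocked in rule (3),
and both leave it exactly one below its upper neighbour. This is where the gap of one step comes
from. -/
theorem IsSequentialUpdate.le_sub {N : ℕ} {y d z : Particle N → ℤ}
    (h : IsSequentialUpdate y d z) {v : Particle N} (hd : |d v| ≤ 1)
    (hv : ¬ ∃ h : v.idx < v.level, z v + 1 = z (v.upper h)) : d v ≤ z v - y v := by
  have hz := h v
  have hd := abs_le.1 hd
  by_cases h1 : 1 < v.idx <;> by_cases h2 : v.idx < v.level <;>
  · simp only [h1, h2, exists_true_left, IsEmpty.exists_iff, if_false] at hz hv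
    split_ifs at hz <;> omega

/-- Only the push in rule (1) and the block in rule (4) move a particle above its driver, and both
leave it level with its lower neighbour; no shift is needed on this side. -/
theorem IsSequentialUpdate.sub_le {N : ℕ} {y d z : Particle N → ℤ}
    (h : IsSequentialUpdate y d z) {v : Particle N} (hd : |d v| ≤ 1)
    (hv : ¬ ∃ h : 1 < v.idx, z (v.lower h) = z v) : z v - y v ≤ d v := by
  have hz := h v
  have hd := abs_le.1 hd
  by_cases h1 : 1 < v.idx <;> by_cases h2 : v.idx < v.level <;>
  · simp only [h1, h2, exists_true_left, IsEmpty.exists_iff, if_false] at hz hv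
    split_ifs at hz <;> omega

theorem CadlagPath.isStepFunction {N : ℕ} (x : CadlagPath (Particle N → ℤ)) :
    IsStepFunction x :=
  x.cadlag.isStepFunction

theorem CadlagPath.eventually_eq_leftLim {N : ℕ} (x : CadlagPath (Particle N → ℤ)) {t : ℝ≥0}
    (ht : 0 < t) : ∀ᶠ s in 𝓝[<] t, x s = Function.leftLim x t := by
  obtain ⟨c, hc⟩ := x.isStepFunction.left t
  have := NNReal.nhdsLT_neBot ht
  have h : Function.leftLim x t = c :=
    leftLim_eq_of_tendsto (tendsto_const_nhds.congr' (hc.mono fun s hs => hs.symm))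
  rwa [h]

theorem IsInterlacingDynamics.update_or_eq {N : ℕ} {x y : CadlagPath (Particle N → ℤ)}
    (h : IsInterlacingDynamics x y) {t : ℝ≥0} (ht : 0 < t) :
    IsSequentialUpdate (Function.leftLim y t) (x t - Function.leftLim x t) (y t) ∨
      (x t = Function.leftLim x t ∧ y t = Function.leftLim y t) := by
  by_cases hx : x t = Function.leftLim x t
  · refine Or.inr ⟨hx, ?_⟩
    obtain ⟨c, hc, hcs⟩ := (mem_nhdsLT_iff_exists_Ioo_subset' ht).1
      ((x.eventually_eq_leftLim ht).and (y.eventually_eq_leftLim ht))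
    obtain ⟨s, hs1, hs2⟩ := exists_between (Set.mem_Iio.1 hc)
    rw [← (hcs ⟨hs1, hs2⟩).2]
    -- Without a jump at `t`, the driver is constant on a whole interval `[s, t]`, so `const`
    -- excludes a jump of `y`.
    refine h.const s t hs2.le (fun r hr => ?_) t ⟨hs2.le, le_rfl⟩
    rw [(hcs ⟨hs1, hs2⟩).1]
    rcases hr.2.lt_or_eq with hrt | rfl
    · exact (hcs ⟨hs1.trans_le hr.1, hrt⟩).1
    · exact hx
  · exact Or.inl (h.jump t hx)

theorem IsInterlacingDynamics.isGelfandTsetlin {N : ℕ} {x y : CadlagPath (Particle N → ℤ)}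
    (h : IsInterlacingDynamics x y) (t : ℝ≥0) : IsGelfandTsetlin (y t) := by
  refine interval_induction (p := fun t => IsGelfandTsetlin (y t)) (a := 0) (T := t) h.init ?_ ?_ t
    zero_le le_rfl
  · intro t ht _ hfr
    obtain ⟨s, hs1, hs2⟩ := (hfr.and_eventually (y.eventually_eq_leftLim ht)).exists
    rw [hs2] at hs1
    rcases h.update_or_eq ht with h1 | h1
    · exact h1.isGelfandTsetlin hs1
    · rwa [h1.2]
  · intro s t _ hst _ hp
    have h2 : ∀ᶠ u in 𝓝[>] s, u ∈ Set.Ioc s t := Ioc_mem_nhdsGT hst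
    obtain ⟨u, hu1, hu2⟩ := ((y.isStepFunction.right s).and h2).exists
    exact ⟨u, hu2, by rwa [hu1]⟩

theorem IsInterlacingDynamics.leftLim_sub_le {N : ℕ} {x y : CadlagPath (Particle N → ℤ)}
    (h : IsInterlacingDynamics x y) (hx : HasUnitSteps x) {t : ℝ≥0} (ht : 0 < t) {v : Particle N}
    (hv : ¬ ∃ h : v.idx < v.level, y t v + 1 = y t (v.upper h)) :
    Function.leftLim y t v - Function.leftLim x t v ≤ y t v - x t v := by
  rcases h.update_or_eq ht with h1 | h1
  · have := h1.le_sub (hx t v) hv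
    simp only [Pi.sub_apply] at this
    linarith
  · rw [h1.1, h1.2]

theorem IsInterlacingDynamics.sub_le_leftLim {N : ℕ} {x y : CadlagPath (Particle N → ℤ)}
    (h : IsInterlacingDynamics x y) (hx : HasUnitSteps x) {t : ℝ≥0} (ht : 0 < t) {v : Particle N}
    (hv : ¬ ∃ h : 1 < v.idx, y t (v.lower h) = y t v) :
    y t v - x t v ≤ Function.leftLim y t v - Function.leftLim x t v := by
  rcases h.update_or_eq ht with h1 | h1
  · have := h1.sub_le (hx t v) hv
    simp only [Pi.sub_apply] at this
    linarith
  · rw [h1.1, h1.2]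

/-- The rescaled interlacing dynamics is a system of reflected paths in which the right barriers
are shifted by one step. -/
theorem IsInterlacingDynamics.isReflectedSystem {N : ℕ} {x y : CadlagPath (Particle N → ℤ)}
    (h : IsInterlacingDynamics x y) (hx : HasUnitSteps x) (a : C(ℝ≥0, ℝ)) {b : ℝ} (hb : 0 < b) :
    IsReflectedSystem (1 / b)
      (fun t v => rescalePath a b y 0 v + (rescalePath a b x t v - rescalePath a b x 0 v))
      (rescalePath a b y) := by
  -- Both `a t` and `a 0` cancel: the constraining term is an integer-valued step function divided
  -- by `b`.
  have hη : ∀ t v, rescalePath a b y t v -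
      (rescalePath a b y 0 v + (rescalePath a b x t v - rescalePath a b x 0 v)) =
      ((y t v - x t v - (y 0 v - x 0 v) : ℤ) : ℝ) / b := by
    intro t v
    simp only [rescalePath]
    push_cast
    ring
  have hstep : IsStepFunction fun t => (y t, x t) :=
    ⟨fun t => ((y.isStepFunction.right t).and (x.isStepFunction.right t)).mono fun s hs => by
      rw [hs.1, hs.2], fun t => by
      obtain ⟨c, hc⟩ := y.isStepFunction.left t
      obtain ⟨c', hc'⟩ := x.isStepFunction.left t
      exact ⟨(c, c'), (hc.and hc').mono fun s hs => by rw [hs.1, hs.2]⟩⟩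
  have hleft : ∀ t, 0 < t → ∀ᶠ s in 𝓝[<] t, (y s, x s) =
      (Function.leftLim y t, Function.leftLim x t) := fun t ht =>
    ((y.eventually_eq_leftLim ht).and (x.eventually_eq_leftLim ht)).mono fun s hs => by
      rw [hs.1, hs.2]
  have hjump : ∀ (f : (Particle N → ℤ) × (Particle N → ℤ) → ℝ) (U : ℝ≥0 → Prop),
      (∀ t, 0 < t → ¬ U t → f (Function.leftLim y t, Function.leftLim x t) ≤ f (y t, x t)) →
      NondecreasingOff (fun t => f (y t, x t)) U := by
    intro f U hf
    refine (hstep.comp f).nondecreasingOff fun t ht hU c hc => ?_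
    have := NNReal.nhdsLT_neBot ht
    obtain ⟨s, hs1, hs2⟩ := (hc.and (hleft t ht)).exists
    rw [← hs1, hs2]
    exact hf t ht hU
  have hgt := h.isGelfandTsetlin
  refine ⟨fun v t => ?_, fun v => by ring, fun t v h1 => ?_, fun t v h1 => ?_, fun v => ?_,
    fun v => ?_⟩
  · simp only [hη]
    obtain ⟨c, hc⟩ := (hstep.comp fun p =>
      ((p.1 v - p.2 v - (y 0 v - x 0 v) : ℤ) : ℝ) / b).left t
    exact ⟨c, tendsto_const_nhds.congr' (hc.mono fun s hs => hs.symm)⟩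
  · have := (hgt t v).1 h1
    simp only [rescalePath]
    gcongr
  · have h2 := (hgt t v).2 h1
    have h3 : (y t v : ℝ) + 1 ≤ y t (v.upper h1) := by exact_mod_cast h2
    simp only [rescalePath]
    rw [← add_div]
    gcongr
    linarith
  · simp only [hη]
    refine hjump (fun p => ((p.1 v - p.2 v - (y 0 v - x 0 v) : ℤ) : ℝ) / b) _ fun t ht hU => ?_
    have := h.leftLim_sub_le hx ht (v := v) fun ⟨h1, he⟩ => hU ⟨h1, by
      simp only [rescalePath, ← he]
      push_cast
      ring⟩
    gcongr
  · simp only [hη]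
    refine hjump (fun p => -(((p.1 v - p.2 v - (y 0 v - x 0 v) : ℤ) : ℝ) / b)) _ fun t ht hU => ?_
    have := h.sub_le_leftLim hx ht (v := v) fun ⟨h1, he⟩ => hU ⟨h1, by
      simp only [rescalePath, ← he]⟩
    simp only
    gcongr

theorem IsGelfandTsetlin.isInterlaced_rescalePath {N : ℕ} {y : CadlagPath (Particle N → ℤ)}
    {t : ℝ≥0} (h : IsGelfandTsetlin (y t)) (a : C(ℝ≥0, ℝ)) {b : ℝ} (hb : 0 < b) :
    IsInterlaced (rescalePath a b y t) := by
  intro v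
  constructor
  · intro h1
    have := (h v).1 h1
    simp only [rescalePath]
    gcongr
  · intro h1
    have := ((h v).2 h1).le
    simp only [rescalePath]
    gcongr

/-! ### Measurability of the interlacing dynamics -/

open Classical in
/-- The configuration obtained from `y` when the driving processes jump by `d`. -/
noncomputable def sequentialUpdate {N : ℕ} (y d : Particle N → ℤ) : Particle N → ℤ :=
  if h : ∃ z, IsSequentialUpdate y d z then h.choose else y

theorem IsSequentialUpdate.eq_sequentialUpdate {N : ℕ} {y d z : Particle N → ℤ}
    (h : IsSequentialUpdate y d z) : z = sequentialUpdate y d := by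
  have hex : ∃ z, IsSequentialUpdate y d z := ⟨z, h⟩
  rw [sequentialUpdate, dif_pos hex]
  exact h.unique hex.choose_spec

/-- Close to `t` the paths can jump only at `t` itself, so two nearby times are separated by at most
one update. If there is none, the update by `0` fixes the configuration. -/
theorem IsInterlacingDynamics.eventually_local {N : ℕ} {x y : CadlagPath (Particle N → ℤ)}
    (h : IsInterlacingDynamics x y) (t : ℝ≥0) :
    ∃ δ > 0, ∀ r ∈ Metric.ball t δ, ∀ s ∈ Metric.ball t δ, r ≤ s →
      y s = sequentialUpdate (y r) (x s - x r) := by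
  have hl : ∀ᶠ s in 𝓝 t, s < t → x s = Function.leftLim x t ∧ y s = Function.leftLim y t := by
    rcases eq_or_ne t 0 with rfl | ht
    · exact Eventually.of_forall fun s hs => absurd hs not_lt_zero
    · have ht := pos_iff_ne_zero.2 ht
      exact eventually_nhdsWithin_iff.1 ((x.eventually_eq_leftLim ht).and (y.eventually_eq_leftLim ht))
  have hr : ∀ᶠ s in 𝓝 t, t < s → x s = x t ∧ y s = y t :=
    eventually_nhdsWithin_iff.1 ((x.isStepFunction.right t).and (y.isStepFunction.right t))
  obtain ⟨δ, hδ, hball⟩ := Metric.eventually_nhds_iff_ball.1 (hl.and hr)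
  have hr' : ∀ s ∈ Metric.ball t δ, t ≤ s → x s = x t ∧ y s = y t := by
    intro s hs hts
    rcases hts.eq_or_lt with rfl | hlt
    · exact ⟨rfl, rfl⟩
    · exact (hball s hs).2 hlt
  have hzero : ∀ r s, x s = x r → y s = y r → y s = sequentialUpdate (y r) (x s - x r) := by
    intro r s h1 h2
    rw [h1, sub_self, h2]
    exact (isSequentialUpdate_zero (h.isGelfandTsetlin r)).eq_sequentialUpdate
  refine ⟨δ, hδ, fun r hrb s hsb hrs => ?_⟩
  rcases lt_or_ge r t with hrt | hrt
  · obtain ⟨e1, e2⟩ := (hball r hrb).1 hrt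
    rcases lt_or_ge s t with hst | hst
    · obtain ⟨e3, e4⟩ := (hball s hsb).1 hst
      exact hzero r s (e3.trans e1.symm) (e4.trans e2.symm)
    · obtain ⟨e3, e4⟩ := hr' s hsb hst
      rcases h.update_or_eq (zero_le.trans_lt hrt) with h1 | h1
      · rw [e1, e2, e3, e4]
        exact h1.eq_sequentialUpdate
      · exact hzero r s (by rw [e3, e1, h1.1]) (by rw [e4, e2, h1.2])
  · obtain ⟨e1, e2⟩ := hr' r hrb hrt
    obtain ⟨e3, e4⟩ := hr' s hsb (hrt.trans hrs)
    exact hzero r s (e3.trans e1.symm) (e4.trans e2.symm)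

/-- The interlacing dynamics in discrete time. -/
noncomputable def sequentialScheme {N : ℕ} (y : Particle N → ℤ) (z : ℕ → Particle N → ℤ) :
    ℕ → Particle N → ℤ
  | 0 => y
  | j + 1 => sequentialUpdate (sequentialScheme y z j) (z (j + 1) - z j)

/-- Once the mesh is below a Lebesgue number of the cover of `[0, T]` by the balls of
`eventually_local`, every grid step is a single update. -/
theorem IsInterlacingDynamics.eventually_eq_scheme {N : ℕ} {x y : CadlagPath (Particle N → ℤ)}
    (h : IsInterlacingDynamics x y) (T : ℝ≥0) :
    ∀ᶠ k in atTop, ∀ j, gridPoint k j ≤ T →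
      y (gridPoint k j) = sequentialScheme (y 0) (fun j => x (gridPoint k j)) j := by
  choose δ hδ hloc using h.eventually_local
  obtain ⟨ρ, hρ, hleb⟩ := lebesgue_number_lemma_of_metric (isCompact_Icc (a := (0 : ℝ≥0)) (b := T))
    (c := fun t => Metric.ball t (δ t)) (fun t => Metric.isOpen_ball)
    (fun t _ => Set.mem_iUnion.2 ⟨t, Metric.mem_ball_self (hδ t)⟩)
  filter_upwards [tendsto_gridPoint_one.eventually (gt_mem_nhds hρ)] with k hk j hj
  induction j with
  | zero => rw [gridPoint_zero]; rfl
  | succ j ih =>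
    have hlt := gridPoint_strictMono k j.lt_succ_self
    rw [sequentialScheme, ← ih (hlt.le.trans hj)]
    obtain ⟨t, ht⟩ := hleb (gridPoint k (j + 1)) ⟨zero_le, hj⟩
    refine hloc t _ (ht ?_) _ (ht (Metric.mem_ball_self hρ)) hlt.le
    rw [Metric.mem_ball, dist_comm, gridPoint_succ, NNReal.dist_eq]
    simpa using hk

theorem measurable_sequentialScheme {N : ℕ} (j : ℕ) :
    Measurable fun p : (Particle N → ℤ) × (ℕ → Particle N → ℤ) => sequentialScheme p.1 p.2 j := by
  induction j with
  | zero => exact measurable_fst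
  | succ j ih =>
    have h1 : Measurable fun q : (Particle N → ℤ) × (Particle N → ℤ) =>
      sequentialUpdate q.1 q.2 := Measurable.of_discrete
    refine h1.comp (ih.prodMk ?_)
    fun_prop

theorem measurable_of_isInterlacingDynamics {N : ℕ} {Ω : Type*} [MeasurableSpace Ω]
    {X Y : Ω → CadlagPath (Particle N → ℤ)} (hX : Measurable X)
    (hY : ∀ ω, IsInterlacingDynamics (X ω) (Y ω)) (hY0 : Measurable fun ω => Y ω 0) :
    Measurable Y := by
  refine CadlagPath.measurable_iff.2 fun t => ?_
  -- The index `gridIndex k t + 1` selects a grid point strictly after `t`; these points tend to `t`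
  -- from the right, where the path is locally constant.
  refine measurable_of_tendsto_metrizable (f := fun k ω => sequentialScheme (Y ω 0)
    (fun j => X ω (gridPoint k j)) (gridIndex k t + 1)) (fun k => ?_) ?_
  · have h1 : Measurable fun ω => (fun j => X ω (gridPoint k j) : ℕ → Particle N → ℤ) :=
      measurable_pi_iff.2 fun j => CadlagPath.measurable_iff.1 hX _
    exact (measurable_sequentialScheme (gridIndex k t + 1)).comp (hY0.prodMk h1)
  · refine tendsto_pi_nhds.2 fun ω => tendsto_const_nhds.congr' ?_
    have h1 : Tendsto (fun k => gridPoint k (gridIndex k t + 1)) atTop (𝓝[>] t) := by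
      refine tendsto_nhdsWithin_iff.2 ⟨?_, Eventually.of_forall fun k => lt_gridPoint_succ k t⟩
      have h2 : Tendsto (fun k => gridPoint k 1) atTop (𝓝 0) := by
        rw [← NNReal.tendsto_coe]; exact tendsto_gridPoint_one
      refine tendsto_of_tendsto_of_tendsto_of_le_of_le tendsto_const_nhds
        (by simpa using h2.const_add t) (fun k => (lt_gridPoint_succ k t).le) fun k => ?_
      rw [gridPoint_succ]
      gcongr
      exact gridPoint_le k t
    filter_upwards [h1.eventually ((Y ω).isStepFunction.right t),
      (hY ω).eventually_eq_scheme (t + 1),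
      h1.eventually (Ioc_mem_nhdsGT (lt_add_one t))] with k e1 e2 e3
    rw [← e1]
    exact e2 _ e3.2

/-! ### Weak convergence by approximation -/

theorem abs_integral_sub_integral_le {Ω : Type*} [MeasurableSpace Ω] {P : Measure Ω}
    [IsProbabilityMeasure P] {f g : Ω → ℝ} (hf : AEStronglyMeasurable f P)
    (hg : AEStronglyMeasurable g P) {C ε η : ℝ} (hC : 0 ≤ C) (hε : 0 ≤ ε) (hη : 0 ≤ η)
    (hfC : ∀ ω, |f ω| ≤ C) (hgC : ∀ ω, |g ω| ≤ C) {B : Set Ω} (hB : P B ≤ ENNReal.ofReal η)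
    (h : ∀ ω, ω ∉ B → |f ω - g ω| ≤ ε) :
    |∫ ω, f ω ∂P - ∫ ω, g ω ∂P| ≤ ε + 2 * C * η := by
  have hfi : Integrable f P := Integrable.of_bound hf C (Eventually.of_forall hfC)
  have hgi : Integrable g P := Integrable.of_bound hg C (Eventually.of_forall hgC)
  -- `B` need not be measurable, since entourages of the path space need not be.
  have hmeas := measurableSet_toMeasurable P B
  have hind : Integrable ((toMeasurable P B).indicator fun _ => 2 * C) P :=
    (integrable_const _).indicator hmeas
  rw [← integral_sub hfi hgi]
  calc |∫ ω, (f ω - g ω) ∂P| ≤ ∫ ω, |f ω - g ω| ∂P := abs_integral_le_integral_abs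
    _ ≤ ∫ ω, (ε + (toMeasurable P B).indicator (fun _ => 2 * C) ω) ∂P := by
      refine integral_mono (hfi.sub hgi).abs ((integrable_const _).add hind) fun ω => ?_
      by_cases hω : ω ∈ toMeasurable P B
      · simp only [Set.indicator_of_mem hω]
        have := abs_sub (f ω) (g ω)
        have := hfC ω
        have := hgC ω
        linarith
      · simp only [Set.indicator_of_notMem hω, add_zero]
        exact h ω fun hB => hω (subset_toMeasurable P B hB)
    _ = ε + 2 * C * P.real B := by
      rw [integral_add (integrable_const _) hind, integral_indicator hmeas]
      simp only [integral_const, smul_eq_mul, measureReal_def, Measure.restrict_apply_univ,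
        measure_univ, measure_toMeasurable, ENNReal.toReal_one]
      ring
    _ ≤ ε + 2 * C * η := by
      gcongr
      exact ENNReal.toReal_le_of_le_ofReal hη hB

/-- Convergence in distribution of `Y n` to `W` on a space `S` which need not be separable, where
`Y n` and `W` are approximated by continuous images of convergent random variables. -/
theorem tendsto_integral_of_approximation {S E : Type*} [UniformSpace S]
    [(uniformity S).IsCountablyGenerated] [TopologicalSpace E] [MeasurableSpace E] [BorelSpace E]
    [HasOuterApproxClosed E] {Ω : ℕ → Type*} [∀ n, MeasurableSpace (Ω n)]
    {P : ∀ n, Measure (Ω n)} [∀ n, IsProbabilityMeasure (P n)] {Ω' : Type*} [MeasurableSpace Ω']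
    {Q : Measure Ω'} [IsProbabilityMeasure Q] {Y : ∀ n, Ω n → S} {W : Ω' → S} {Ψ : ℕ → E → S}
    (hΨ : ∀ k, Continuous (Ψ k)) {Z : ℕ → ∀ n, Ω n → E} {Z' : ℕ → Ω' → E}
    (hZ : ∀ k, TendstoInDistribution (Z k) atTop (Z' k) P Q)
    (hY : ∀ V ∈ uniformity S, ∀ ε > 0, ∀ᶠ k in atTop, ∀ᶠ n in atTop,
      P n {ω | (Ψ k (Z k n ω), Y n ω) ∉ V} ≤ ENNReal.ofReal ε)
    (hW : ∀ V ∈ uniformity S, ∀ ε > 0, ∀ᶠ k in atTop,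
      Q {ω | (Ψ k (Z' k ω), W ω) ∉ V} ≤ ENNReal.ofReal ε)
    {g : S → ℝ} (hg : Continuous g) {C : ℝ} (hgC : ∀ x, |g x| ≤ C)
    (hgY : ∀ n, AEStronglyMeasurable (fun ω => g (Y n ω)) (P n))
    (hgW : AEStronglyMeasurable (fun ω => g (W ω)) Q) :
    Tendsto (fun n => ∫ ω, g (Y n ω) ∂(P n)) atTop (𝓝 (∫ ω, g (W ω) ∂Q)) := by
  let := UniformSpace.pseudoMetricSpace S
  obtain ⟨ω₀⟩ : Nonempty Ω' := Q.nonempty_of_neZero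
  have hC : 0 ≤ C := (abs_nonneg _).trans (hgC (W ω₀))
  refine Metric.tendsto_atTop'.2 fun ε₀ hε₀ => ?_
  -- Replacing `Y n` and `W` by their approximations costs `2 * ε + 6 * C * ε` each; the convergence
  -- of the approximations costs one more `ε`.
  obtain ⟨ε, hε, hεε₀⟩ : ∃ ε > 0, 5 * ε + 12 * C * ε < ε₀ := by
    refine ⟨ε₀ / (5 + 12 * C + 1), by positivity, ?_⟩
    rw [← add_mul, mul_div_assoc', div_lt_iff₀ (by positivity)]
    nlinarith
  -- `g` need not be uniformly continuous. These sets exhaust `S` as `ρ` decreases to `0`, and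
  -- continuity from below, valid for arbitrary sets, gives one that contains `W` with outer
  -- probability above `1 - ε`.
  set A : ℝ → Set S := fun ρ => {x | ∀ y, dist x y < ρ → |g x - g y| ≤ ε} with hA
  obtain ⟨ρ, hρ, hAρ⟩ : ∃ ρ > 0, 1 < Q (W ⁻¹' A ρ) + ENNReal.ofReal ε := by
    have hmono : Monotone fun m : ℕ => W ⁻¹' A (1 / ((m : ℝ) + 1)) := by
      intro m n hmn ω hω y hy
      refine hω y (hy.trans_le ?_)
      gcongr
    have hun : ⋃ m : ℕ, W ⁻¹' A (1 / ((m : ℝ) + 1)) = Set.univ := by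
      refine Set.eq_univ_of_forall fun ω => Set.mem_iUnion.2 ?_
      obtain ⟨δ, hδ, h⟩ := Metric.continuousAt_iff.1 (hg.continuousAt (x := W ω)) ε hε
      obtain ⟨m, hm⟩ := exists_nat_one_div_lt hδ
      refine ⟨m, fun y hy => ?_⟩
      rw [abs_sub_comm]
      rw [dist_comm] at hy
      exact (h (hy.trans hm)).le
    have ht := tendsto_measure_iUnion_atTop (μ := Q) hmono
    rw [hun, measure_univ] at ht
    have h1 : (1 : ENNReal) - ENNReal.ofReal ε < 1 :=
      ENNReal.sub_lt_self ENNReal.one_ne_top one_ne_zero (by simpa using hε)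
    obtain ⟨m, hm⟩ := (ht.eventually (lt_mem_nhds h1)).exists
    refine ⟨1 / ((m : ℝ) + 1), by positivity, ?_⟩
    by_contra! hcon
    exact absurd (ENNReal.le_sub_of_add_le_right ENNReal.ofReal_ne_top hcon) (not_le.2 hm)
  -- The open thickening retains control of `g` with `2 * ε` and `ρ / 2`. Its preimage under the
  -- continuous `Ψ k` is open in `E`, so portmanteau applies to the complement `F`.
  set G := Metric.thickening (ρ / 2) (A ρ) with hG
  have hGclose : ∀ x ∈ G, ∀ y, dist x y < ρ / 2 → |g x - g y| ≤ 2 * ε := by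
    intro x hx y hxy
    obtain ⟨z, hz, hxz⟩ := Metric.mem_thickening_iff.1 hx
    have h1 : dist z x < ρ := by rw [dist_comm]; linarith
    have h2 : dist z y < ρ := by
      have := dist_triangle z x y
      rw [dist_comm z x] at this
      linarith
    have h3 := abs_le.1 (hz x h1)
    have h4 := abs_le.1 (hz y h2)
    rw [abs_le]
    constructor <;> linarith
  have hV : {p : S × S | dist p.1 p.2 < ρ / 2} ∈ uniformity S := Metric.dist_mem_uniformity (by positivity)
  obtain ⟨k, hk1, hk2⟩ := ((hY _ hV ε hε).and (hW _ hV ε hε)).exists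
  set F : Set E := (Ψ k ⁻¹' G)ᶜ with hF
  have hFc : IsClosed F := (Metric.isOpen_thickening.preimage (hΨ k)).isClosed_compl
  have hZmeas : AEMeasurable (Z' k) Q := (hZ k).aemeasurable_limit
  have hQF : (Q.map (Z' k)) F < ENNReal.ofReal (2 * ε) := by
    rw [Measure.map_apply_of_aemeasurable hZmeas hFc.measurableSet]
    have hnull : NullMeasurableSet (Z' k ⁻¹' F) Q :=
      hZmeas.nullMeasurableSet_preimage hFc.measurableSet
    have h1 : Q (W ⁻¹' A ρ) ≤ Q (Z' k ⁻¹' F)ᶜ + ENNReal.ofReal ε := by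
      refine (measure_mono fun ω hω => ?_).trans
        ((measure_union_le _ _).trans (add_le_add_right hk2 _))
      by_cases hd : dist (Ψ k (Z' k ω)) (W ω) < ρ / 2
      · left
        simp only [hF, Set.mem_compl_iff, Set.mem_preimage, not_not]
        exact Metric.mem_thickening_iff.2 ⟨W ω, hω, hd⟩
      · right
        exact hd
    have h2 : Q (Z' k ⁻¹' F) + Q (Z' k ⁻¹' F)ᶜ = 1 := by
      rw [measure_add_measure_compl₀ hnull, measure_univ]
    have h3 : Q (Z' k ⁻¹' F) + Q (Z' k ⁻¹' F)ᶜ <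
        ENNReal.ofReal (2 * ε) + Q (Z' k ⁻¹' F)ᶜ := by
      rw [h2, two_mul, ENNReal.ofReal_add hε.le hε.le, add_comm, ← add_assoc]
      exact hAρ.trans_le (by gcongr)
    exact lt_of_add_lt_add_right h3
  have hPF : ∀ᶠ n in atTop, (P n) (Z k n ⁻¹' F) < ENNReal.ofReal (2 * ε) := by
    have h1 := ProbabilityMeasure.limsup_measure_closed_le_of_tendsto (hZ k).tendsto hFc
    filter_upwards [eventually_lt_of_limsup_lt (h1.trans_lt hQF)] with n hn
    rwa [ProbabilityMeasure.coe_mk, Measure.map_apply_of_aemeasurable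
      ((hZ k).forall_aemeasurable n) hFc.measurableSet] at hn
  have hcont : Continuous fun e => g (Ψ k e) := hg.comp (hΨ k)
  have hlim : Tendsto (fun n => ∫ ω, g (Ψ k (Z k n ω)) ∂(P n)) atTop
      (𝓝 (∫ ω, g (Ψ k (Z' k ω)) ∂Q)) := by
    have h1 := ProbabilityMeasure.tendsto_iff_forall_integral_tendsto.1 (hZ k).tendsto
      (BoundedContinuousFunction.ofNormedAddCommGroup (fun e => g (Ψ k e)) hcont C
        fun e => hgC _)
    simp only [ProbabilityMeasure.coe_mk,
      BoundedContinuousFunction.coe_ofNormedAddCommGroup] at h1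
    rw [integral_map hZmeas hcont.aestronglyMeasurable] at h1
    refine h1.congr fun n => ?_
    rw [integral_map ((hZ k).forall_aemeasurable n) hcont.aestronglyMeasurable]
  have hsum : ENNReal.ofReal (2 * ε) + ENNReal.ofReal ε = ENNReal.ofReal (3 * ε) := by
    rw [← ENNReal.ofReal_add (by positivity) hε.le]
    ring_nf
  have hclose' : |∫ ω, g (Ψ k (Z' k ω)) ∂Q - ∫ ω, g (W ω) ∂Q| ≤ 2 * ε + 2 * C * (3 * ε) := by
    refine abs_integral_sub_integral_le
      (hcont.measurable.comp_aemeasurable hZmeas).aestronglyMeasurable hgW hC (by positivity)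
      (by positivity) (fun _ => hgC _) (fun _ => hgC _)
      (B := Z' k ⁻¹' F ∪ {ω | (Ψ k (Z' k ω), W ω) ∉ {p : S × S | dist p.1 p.2 < ρ / 2}}) ?_ ?_
    · rw [Measure.map_apply_of_aemeasurable hZmeas hFc.measurableSet] at hQF
      exact (measure_union_le _ _).trans (hsum ▸ add_le_add hQF.le hk2)
    · intro ω hω
      simp only [hF, Set.mem_union, not_or, Set.mem_preimage, Set.mem_compl_iff, not_not,
        Set.mem_ofPred_eq] at hω
      exact hGclose _ hω.1 _ hω.2
  have hev : ∀ᶠ n in atTop, dist (∫ ω, g (Y n ω) ∂(P n)) (∫ ω, g (W ω) ∂Q) < ε₀ := by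
    filter_upwards [hPF, hk1, Metric.tendsto_nhds.1 hlim ε hε] with n hn1 hn2 hn3
    have hclose : |∫ ω, g (Ψ k (Z k n ω)) ∂(P n) - ∫ ω, g (Y n ω) ∂(P n)| ≤
        2 * ε + 2 * C * (3 * ε) := by
      refine abs_integral_sub_integral_le
        (hcont.measurable.comp_aemeasurable ((hZ k).forall_aemeasurable n)).aestronglyMeasurable
        (hgY n) hC (by positivity) (by positivity) (fun _ => hgC _) (fun _ => hgC _)
        (B := Z k n ⁻¹' F ∪ {ω | (Ψ k (Z k n ω), Y n ω) ∉ {p : S × S | dist p.1 p.2 < ρ / 2}}) ?_ ?_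
      · exact (measure_union_le _ _).trans (hsum ▸ add_le_add hn1.le hn2)
      · intro ω hω
        simp only [hF, Set.mem_union, not_or, Set.mem_preimage, Set.mem_compl_iff, not_not,
          Set.mem_ofPred_eq] at hω
        exact hGclose _ hω.1 _ hω.2
    rw [Real.dist_eq] at hn3 ⊢
    rw [abs_le] at hclose hclose'
    rw [abs_lt] at hn3 ⊢
    constructor <;> linarith
  obtain ⟨n₀, hn₀⟩ := eventually_atTop.1 hev
  exact ⟨n₀, fun n hn => hn₀ n hn.le⟩

/-- By independence the joint laws are product measures, and forming products is continuous for weak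
convergence. -/
theorem tendstoInDistribution_prodMk {E F : Type*} [TopologicalSpace E] [TopologicalSpace F]
    [MeasurableSpace E] [MeasurableSpace F] [BorelSpace E] [BorelSpace F]
    [SecondCountableTopology E] [SecondCountableTopology F]
    [TopologicalSpace.PseudoMetrizableSpace E] [TopologicalSpace.PseudoMetrizableSpace F]
    {Ω : ℕ → Type*} [∀ n, MeasurableSpace (Ω n)]
    {P : ∀ n, Measure (Ω n)} [∀ n, IsProbabilityMeasure (P n)] {Ω₁ Ω₂ Ω' : Type*}
    [MeasurableSpace Ω₁] [MeasurableSpace Ω₂] [MeasurableSpace Ω'] {μ₁ : Measure Ω₁}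
    {μ₂ : Measure Ω₂} {Q : Measure Ω'} [IsProbabilityMeasure μ₁] [IsProbabilityMeasure μ₂]
    [IsProbabilityMeasure Q] {X : ∀ n, Ω n → E} {U : ∀ n, Ω n → F} {X₁ : Ω₁ → E} {U₂ : Ω₂ → F}
    {X' : Ω' → E} {U' : Ω' → F} (hX : TendstoInDistribution X atTop X₁ P μ₁)
    (hU : TendstoInDistribution U atTop U₂ P μ₂) (hind : ∀ n, IndepFun (X n) (U n) (P n))
    (hX' : AEMeasurable X' Q) (hU' : AEMeasurable U' Q) (hind' : IndepFun X' U' Q)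
    (hXlaw : Q.map X' = μ₁.map X₁) (hUlaw : Q.map U' = μ₂.map U₂) :
    TendstoInDistribution (fun n ω => (X n ω, U n ω)) atTop (fun ω => (X' ω, U' ω)) P Q where
  forall_aemeasurable n := (hX.forall_aemeasurable n).prodMk (hU.forall_aemeasurable n)
  aemeasurable_limit := hX'.prodMk hU'
  tendsto := by
    have h := (ProbabilityMeasure.continuous_prod.tendsto _).comp
      (hX.tendsto.prodMk_nhds hU.tendsto)
    have hlim : ProbabilityMeasure.prod
        ⟨μ₁.map X₁, Measure.isProbabilityMeasure_map hX.aemeasurable_limit⟩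
        ⟨μ₂.map U₂, Measure.isProbabilityMeasure_map hU.aemeasurable_limit⟩ =
        ⟨Q.map fun ω => (X' ω, U' ω), Measure.isProbabilityMeasure_map (hX'.prodMk hU')⟩ := by
      have hprod : (μ₁.map X₁).prod (μ₂.map U₂) = Q.map fun ω => (X' ω, U' ω) := by
        rw [(indepFun_iff_map_prod_eq_prod_map_map hX' hU').1 hind', hXlaw, hUlaw]
      exact Subtype.ext hprod
    refine (hlim ▸ h).congr fun n => Subtype.ext ?_
    exact ((indepFun_iff_map_prod_eq_prod_map_map (hX.forall_aemeasurable n)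
      (hU.forall_aemeasurable n)).1 (hind n)).symm

/-! ### Oscillations on the scale of the grid -/

/-- The supremum over a countable dense set of times `t < T`, truncated at `1`, of the distance of
`x t` to the value of `x` at the preceding grid point. -/
noncomputable def gridOscillation {N : ℕ} (T : ℝ≥0) (k : ℕ) (x : ℝ≥0 → Particle N → ℝ) : ℝ :=
  ⨆ p : ℕ × Particle N, if TopologicalSpace.denseSeq ℝ≥0 p.1 < T then
    min 1 |x (TopologicalSpace.denseSeq ℝ≥0 p.1) p.2 -
      x (gridPoint k (gridIndex k (TopologicalSpace.denseSeq ℝ≥0 p.1))) p.2| else 0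

section GridOscillation

variable {N : ℕ} (T : ℝ≥0) (k : ℕ)

theorem gridOscillation_bddAbove (x : ℝ≥0 → Particle N → ℝ) :
    BddAbove (Set.range fun p : ℕ × Particle N => if TopologicalSpace.denseSeq ℝ≥0 p.1 < T then
    min 1 |x (TopologicalSpace.denseSeq ℝ≥0 p.1) p.2 -
      x (gridPoint k (gridIndex k (TopologicalSpace.denseSeq ℝ≥0 p.1))) p.2| else 0) := by
  refine ⟨1, ?_⟩
  rintro _ ⟨p, rfl⟩
  dsimp only
  split_ifs
  · exact min_le_left _ _
  · exact zero_le_one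

theorem gridOscillation_nonneg (x : ℝ≥0 → Particle N → ℝ) : 0 ≤ gridOscillation T k x := by
  refine Real.iSup_nonneg fun p => ?_
  split_ifs <;> positivity

theorem gridOscillation_le_one (x : ℝ≥0 → Particle N → ℝ) : gridOscillation T k x ≤ 1 := by
  refine Real.iSup_le (fun p => ?_) zero_le_one
  split_ifs
  · exact min_le_left _ _
  · exact zero_le_one

theorem measurable_gridOscillation : Measurable (gridOscillation (N := N) T k) := by
  refine Measurable.iSup fun p => ?_
  split_ifs
  · have h : ∀ t : ℝ≥0, Measurable fun x : ℝ≥0 → Particle N → ℝ => x t p.2 := fun t =>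
      (measurable_pi_apply p.2).comp (measurable_pi_apply t)
    exact measurable_const.min ((h _).sub (h _)).abs
  · exact measurable_const

theorem gridOscillation_le_add {x y : ℝ≥0 → Particle N → ℝ} {ε : ℝ}
    (h : ∀ t ≤ T, ∀ v, |x t v - y t v| ≤ ε) (hε : 0 ≤ ε) :
    gridOscillation T k x ≤ gridOscillation T k y + 2 * ε := by
  have h0 := gridOscillation_nonneg T k y
  refine Real.iSup_le (fun p => ?_) (by positivity)
  have h1 := le_ciSup (gridOscillation_bddAbove T k y) p
  split_ifs at h1 ⊢ with hp
  · refine le_trans ?_ (add_le_add_left h1 _)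
    have h2 := h _ hp.le p.2
    have h3 := h _ ((gridPoint_le k _).trans hp.le) p.2
    rw [← sub_le_iff_le_add]
    refine le_min ?_ ?_
    · have := min_le_left 1 |x (TopologicalSpace.denseSeq ℝ≥0 p.1) p.2 -
        x (gridPoint k (gridIndex k (TopologicalSpace.denseSeq ℝ≥0 p.1))) p.2|
      linarith
    · refine (sub_le_sub_right (min_le_right _ _) _).trans ?_
      rw [sub_le_iff_le_add]
      have h4 := abs_add_three (x (TopologicalSpace.denseSeq ℝ≥0 p.1) p.2 -
        y (TopologicalSpace.denseSeq ℝ≥0 p.1) p.2)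
        (y (TopologicalSpace.denseSeq ℝ≥0 p.1) p.2 -
        y (gridPoint k (gridIndex k (TopologicalSpace.denseSeq ℝ≥0 p.1))) p.2)
        (y (gridPoint k (gridIndex k (TopologicalSpace.denseSeq ℝ≥0 p.1))) p.2 -
        x (gridPoint k (gridIndex k (TopologicalSpace.denseSeq ℝ≥0 p.1))) p.2)
      rw [abs_sub_comm (x (gridPoint k _) p.2)] at h3
      refine le_trans (le_of_eq ?_) (h4.trans (by linarith))
      congr 1
      ring
  · positivity

theorem continuous_gridOscillation :
    Continuous fun x : CadlagPath (Particle N → ℝ) => gridOscillation T k x := by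
  refine continuous_iff_continuousAt.2 fun x => Metric.tendsto_nhds.2 fun ε hε => ?_
  filter_upwards [CadlagPath.eventually_nhds x T (ε := ε / 3) (by positivity)] with y hy
  have h1 := gridOscillation_le_add T k (fun t ht v => (hy t ht v).le) (by positivity)
  have h2 := gridOscillation_le_add T k (x := y) (y := x)
    (fun t ht v => by rw [abs_sub_comm]; exact (hy t ht v).le) (by positivity)
  rw [Real.dist_eq, abs_lt]
  constructor <;> linarith

/-- A violation at `t` persists just to the right of `t`, by right-continuity and since the grid
index is constant there, so some dense time sees it. The bound `ε ≤ 1` makes the truncation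
harmless. -/
theorem abs_sub_gridPoint_le_of_gridOscillation_lt {x : ℝ≥0 → Particle N → ℝ}
    (hx : ∀ t, ContinuousWithinAt x (Set.Ici t) t) {ε : ℝ} (hε1 : ε ≤ 1)
    (h : gridOscillation T k x < ε) (t : ℝ≥0) (ht : t < T) (v : Particle N) :
    |x t v - x (gridPoint k (gridIndex k t)) v| ≤ ε := by
  by_contra! hlt
  have h1 : Tendsto (fun s => |x s v - x (gridPoint k (gridIndex k s)) v|) (𝓝[>] t)
      (𝓝 |x t v - x (gridPoint k (gridIndex k t)) v|) := by
    have h2 : Tendsto (fun s => x s v) (𝓝[>] t) (𝓝 (x t v)) :=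
      tendsto_pi_nhds.1 (continuousWithinAt_Ioi_iff_Ici.2 (hx t)) v
    refine (h2.sub (tendsto_const_nhds.congr' ?_)).abs
    exact ((isStepFunction_gridIndex k).right t).mono fun s hs => by simp only [hs]
  obtain ⟨u, hu, hus⟩ := (mem_nhdsGT_iff_exists_Ioo_subset' ht).1
    ((h1.eventually (lt_mem_nhds hlt)).and (Ioo_mem_nhdsGT ht))
  obtain ⟨i, hi⟩ := (TopologicalSpace.denseRange_denseSeq ℝ≥0).exists_mem_open isOpen_Ioo
    (Set.nonempty_Ioo.2 (Set.mem_Ioi.1 hu))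
  obtain ⟨h2, h3⟩ := hus hi
  have h4 := (le_ciSup (gridOscillation_bddAbove T k x) (i, v)).trans_lt h
  simp only [if_pos h3.2] at h4
  exact absurd h4 (not_lt.2 (le_min hε1 h2.le))

end GridOscillation

theorem tendsto_gridOscillation {N : ℕ} (T : ℝ≥0) {x : ℝ≥0 → Particle N → ℝ} (hx : Continuous x) :
    Tendsto (fun k => gridOscillation T k x) atTop (𝓝 0) := by
  refine Metric.tendsto_nhds.2 fun ε hε => ?_
  filter_upwards [eventually_abs_sub_gridPoint_lt hx T (half_pos hε)] with k hk
  rw [Real.dist_0_eq_abs, abs_of_nonneg (gridOscillation_nonneg T k x)]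
  refine lt_of_le_of_lt (Real.iSup_le (fun p => ?_) (half_pos hε).le) (half_lt_self hε)
  split_ifs with hp
  · exact (min_le_right _ _).trans (hk _ hp.le p.2).le
  · positivity

theorem tendsto_integral_gridOscillation {N : ℕ} {Ω : Type*} [MeasurableSpace Ω] {P : Measure Ω}
    [IsProbabilityMeasure P] {B : ℝ≥0 → Ω → Particle N → ℝ} (hB : ∀ t, Measurable (B t))
    (hc : ∀ᵐ ω ∂P, Continuous fun t => B t ω) (T : ℝ≥0) :
    Tendsto (fun k => ∫ ω, gridOscillation T k (fun t => B t ω) ∂P) atTop (𝓝 0) := by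
  have h := tendsto_integral_of_dominated_convergence (μ := P)
    (F := fun k ω => gridOscillation T k (fun t => B t ω)) (f := fun _ => 0) (fun _ => 1)
    (fun k => ((measurable_gridOscillation T k).comp (measurable_pi_iff.2 hB)).aestronglyMeasurable)
    (integrable_const _) (fun k => Eventually.of_forall fun ω => ?_) ?_
  · simpa using h
  · rw [Real.norm_of_nonneg (gridOscillation_nonneg _ _ _)]
    exact gridOscillation_le_one _ _ _
  · filter_upwards [hc] with ω hω using tendsto_gridOscillation T hω

theorem measure_le_gridOscillation_le {N : ℕ} {Ω : Type*} [MeasurableSpace Ω] {P : Measure Ω}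
    [IsProbabilityMeasure P] {B : ℝ≥0 → Ω → Particle N → ℝ} (hB : ∀ t, Measurable (B t))
    {T : ℝ≥0} {k : ℕ} {δ ε : ℝ} (hδ : 0 < δ)
    (h : ∫ ω, gridOscillation T k (fun t => B t ω) ∂P ≤ δ * ε) :
    P {ω | δ ≤ gridOscillation T k (fun t => B t ω)} ≤ ENNReal.ofReal ε := by
  have hm : Measurable fun ω => gridOscillation T k (fun t => B t ω) :=
    (measurable_gridOscillation T k).comp (measurable_pi_iff.2 hB)
  have hint : Integrable (fun ω => gridOscillation T k (fun t => B t ω)) P :=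
    Integrable.of_bound hm.aestronglyMeasurable 1 (Eventually.of_forall fun ω => by
      rw [Real.norm_of_nonneg (gridOscillation_nonneg _ _ _)]
      exact gridOscillation_le_one _ _ _)
  have h1 := mul_meas_ge_le_integral_of_nonneg
    (Eventually.of_forall fun ω => gridOscillation_nonneg T k (fun t => B t ω)) hint δ
  have h2 := le_of_mul_le_mul_left (h1.trans h) hδ
  rw [← ofReal_measureReal]
  exact ENNReal.ofReal_le_ofReal h2

/-! ### Laws of Brownian motions -/

namespace IsStandardBrownianMotion

variable {ι Ω Ω' : Type*} [MeasurableSpace Ω] [MeasurableSpace Ω'] {B : ℝ≥0 → Ω → ι → ℝ}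
  {B' : ℝ≥0 → Ω' → ι → ℝ} {P : Measure Ω} {P' : Measure Ω'}

theorem measurable_coord (hB : IsStandardBrownianMotion B P) (v : ι) :
    Measurable fun ω (t : ℝ≥0) => B t ω v :=
  measurable_pi_iff.2 fun t => (measurable_pi_apply v).comp (hB.measurable t)

theorem ae_continuous [Countable ι] (hB : IsStandardBrownianMotion B P) :
    ∀ᵐ ω ∂P, Continuous fun t => B t ω := by
  filter_upwards [ae_all_iff.2 fun v => (hB.brownian v).cont] with ω hω
  exact continuous_pi hω

theorem ae_zero [Countable ι] (hB : IsStandardBrownianMotion B P) : ∀ᵐ ω ∂P, B 0 ω = 0 := by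
  filter_upwards [ae_all_iff.2 fun v => (hB.brownian v).eval_zero_ae_eq_zero] with ω hω
  exact funext hω

/-- Any two standard Brownian motions have the same law. -/
theorem map_eq_map [Finite ι] (hB : IsStandardBrownianMotion B P)
    (hB' : IsStandardBrownianMotion B' P') :
    P.map (fun ω t => B t ω) = P'.map (fun ω t => B' t ω) := by
  have := hB.isProbabilityMeasure
  have := hB'.isProbabilityMeasure
  let := Fintype.ofFinite ι
  have hcoord : ∀ v, P.map (fun ω (t : ℝ≥0) => B t ω v) = P'.map fun ω (t : ℝ≥0) => B' t ω v := by
    intro v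
    -- Each coordinate law is determined by its finite-dimensional marginals; independence then
    -- determines the joint law.
    refine IsProjectiveLimit.unique (P := BrownianReal.projectiveFamily) (fun I => ?_) fun I => ?_
    · rw [Measure.map_map (by fun_prop) (hB.measurable_coord v)]
      exact ((hB.brownian v).hasLaw I).map_eq
    · rw [Measure.map_map (by fun_prop) (hB'.measurable_coord v)]
      exact ((hB'.brownian v).hasLaw I).map_eq
  have hjoint : P.map (fun ω v (t : ℝ≥0) => B t ω v) = P'.map fun ω v (t : ℝ≥0) => B' t ω v := by
    rw [(iIndepFun_iff_map_fun_eq_pi_map fun v => (hB.measurable_coord v).aemeasurable).1 hB.indep,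
      (iIndepFun_iff_map_fun_eq_pi_map fun v => (hB'.measurable_coord v).aemeasurable).1 hB'.indep]
    simp only [hcoord]
  have hswap : Measurable fun (f : ι → ℝ≥0 → ℝ) (t : ℝ≥0) (v : ι) => f v t :=
    measurable_pi_iff.2 fun t => measurable_pi_iff.2 fun v =>
      (measurable_pi_apply t).comp (measurable_pi_apply v)
  have h := congrArg (fun μ => μ.map fun (f : ι → ℝ≥0 → ℝ) (t : ℝ≥0) (v : ι) => f v t) hjoint
  rwa [Measure.map_map hswap (measurable_pi_iff.2 hB.measurable_coord),
    Measure.map_map hswap (measurable_pi_iff.2 hB'.measurable_coord)] at h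

theorem comp_measurePreserving [Finite ι] (hB : IsStandardBrownianMotion B P) {f : Ω' → Ω}
    (hf : MeasurePreserving f P' P) : IsStandardBrownianMotion (fun t ω => B t (f ω)) P' := by
  have hP := hB.isProbabilityMeasure
  have hP' : IsProbabilityMeasure P' :=
    ⟨by simpa using hf.measure_preimage MeasurableSet.univ.nullMeasurableSet⟩
  let := Fintype.ofFinite ι
  refine ⟨hP', fun t => (hB.measurable t).comp hf.measurable,
    fun v => ⟨⟨fun I => ((hB.brownian v).hasLaw I).comp hf.hasLaw⟩,
      hf.quasiMeasurePreserving.ae (hB.brownian v).cont⟩, ?_⟩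
  have hm : ∀ v, Measurable fun ω (t : ℝ≥0) => B t (f ω) v := fun v =>
    (hB.measurable_coord v).comp hf.measurable
  rw [iIndepFun_iff_map_fun_eq_pi_map fun v => (hm v).aemeasurable]
  have h1 := (iIndepFun_iff_map_fun_eq_pi_map fun v =>
    (hB.measurable_coord v).aemeasurable).1 hB.indep
  rw [← hf.map_eq, Measure.map_map (measurable_pi_iff.2 hB.measurable_coord) hf.measurable] at h1
  refine h1.trans ?_
  congr 1
  funext v
  rw [Measure.map_map (hB.measurable_coord v) hf.measurable]
  rfl

end IsStandardBrownianMotion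

/-! ### Existence of the reflected process -/

theorem isClosed_isInterlaced (N : ℕ) : IsClosed {x : Particle N → ℝ | IsInterlaced x} := by
  simp only [IsInterlaced, Set.ofPred_forall, Set.ofPred_and]
  refine isClosed_iInter fun v => IsClosed.inter ?_ ?_ <;> refine isClosed_iInter fun h => ?_
  · exact isClosed_le (continuous_apply _) (continuous_apply _)
  · exact isClosed_le (continuous_apply _) (continuous_apply _)

/-- On `β.prod μ₀` the reflected system is solved path by path off a null set, and the solution is
measurable as a pointwise limit of grid paths. -/
theorem exists_isWarrenLaw {N : ℕ} {β : Measure (CadlagPath (Particle N → ℝ))}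
    (hβ : IsStandardBrownianMotion (fun t (x : CadlagPath (Particle N → ℝ)) => x t) β)
    (μ₀ : Measure (Particle N → ℝ)) [IsProbabilityMeasure μ₀]
    (hμ₀ : ∀ᵐ y ∂μ₀, IsInterlaced y) : ∃ ν, IsWarrenLaw μ₀ ν := by
  have hβp := hβ.isProbabilityMeasure
  set Q : Measure (CadlagPath (Particle N → ℝ) × (Particle N → ℝ)) := β.prod μ₀ with hQ
  have hfst : MeasurePreserving Prod.fst Q β := measurePreserving_fst
  have hsnd : MeasurePreserving Prod.snd Q μ₀ := measurePreserving_snd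
  have hgood : ∀ᵐ ω ∂Q, Continuous (fun t => ω.1 t) ∧ ω.1 0 = 0 ∧ IsInterlaced ω.2 := by
    filter_upwards [hfst.quasiMeasurePreserving.ae hβ.ae_continuous,
      hfst.quasiMeasurePreserving.ae hβ.ae_zero, hsnd.quasiMeasurePreserving.ae hμ₀]
      with ω h1 h2 h3 using ⟨h1, h2, h3⟩
  -- The bad event is enlarged to a measurable null set so that setting `W` to `0` on it preserves
  -- measurability.
  obtain ⟨H, hHsub, hHm, hHnull⟩ := exists_measurable_superset_of_null (ae_iff.1 hgood)
  have hH : ∀ ω, ω ∉ H → Continuous (fun t => ω.1 t) ∧ ω.1 0 = 0 ∧ IsInterlaced ω.2 := by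
    intro ω hω
    by_contra hcon
    exact hω (hHsub hcon)
  have hHae : ∀ᵐ ω ∂Q, ω ∉ H := measure_eq_zero_iff_ae_notMem.1 hHnull
  have hex : ∀ ω : CadlagPath (Particle N → ℝ) × (Particle N → ℝ),
      ∃ w : CadlagPath (Particle N → ℝ), (ω ∈ H → ∀ t, w t = 0) ∧ (ω ∉ H → Continuous w.toFun ∧
        (∀ t v, Tendsto (fun k => gridPath k (ω.2, fun j => ω.1 (gridPoint k j)) t v) atTop
          (𝓝 (w t v))) ∧ IsReflectedSystem 0 (fun t v => ω.2 v + ω.1 t v) w) := by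
    intro ω
    have hcad : ∀ f : ℝ≥0 → Particle N → ℝ, Continuous f → IsCadlag f := fun f hf t =>
      ⟨hf.continuousWithinAt, f t, (hf.tendsto t).mono_left nhdsWithin_le_nhds⟩
    by_cases hω : ω ∈ H
    · exact ⟨⟨fun _ => 0, hcad _ continuous_const⟩, fun _ _ => rfl, fun h => absurd hω h⟩
    · obtain ⟨h1, h2, h3⟩ := hH ω hω
      obtain ⟨w, hw1, hw2, hw3⟩ := exists_reflectedSystem h1 h2 h3
      exact ⟨⟨w, hcad w hw1⟩, fun h => absurd h hω, fun _ => ⟨hw1, hw2, hw3⟩⟩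
  choose W hW0 hW using hex
  have hWm : Measurable W := by
    classical
    refine CadlagPath.measurable_iff.2 fun t => ?_
    refine measurable_of_tendsto_metrizable (f := fun k ω => if ω ∈ H then 0 else
      gridPath k (ω.2, fun j => ω.1 (gridPoint k j)) t) (fun k => ?_) ?_
    · refine Measurable.ite hHm measurable_const ?_
      have h1 : Measurable fun p : (Particle N → ℝ) × (ℕ → Particle N → ℝ) => gridPath k p t :=
        (continuous_reflectScheme (gridIndex k t)).measurable
      have h2 : Measurable fun ω : CadlagPath (Particle N → ℝ) × (Particle N → ℝ) =>
          (fun j => ω.1 (gridPoint k j) : ℕ → Particle N → ℝ) :=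
        measurable_pi_iff.2 fun j => (CadlagPath.measurable_eval _).comp measurable_fst
      exact h1.comp (measurable_snd.prodMk h2)
    · refine tendsto_pi_nhds.2 fun ω => ?_
      by_cases hω : ω ∈ H
      · simp only [if_pos hω, hW0 ω hω t]
        exact tendsto_const_nhds
      · simp only [if_neg hω]
        exact tendsto_pi_nhds.2 fun v => (hW ω hω).2.1 t v
  have hinit : ∀ ω, ω ∉ H → W ω 0 = ω.2 := by
    intro ω hω
    funext v
    rw [(hW ω hω).2.2.zero v, (hH ω hω).2.1]
    simp
  have hinit' : (fun ω => W ω 0) =ᵐ[Q] Prod.snd := hHae.mono hinit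
  have hB := hβ.comp_measurePreserving hfst
  refine ⟨Q.map W, _, inferInstance, Q, fun t ω => ω.1 t, W, ⟨hB, hWm, ?_, ?_⟩, ?_, rfl⟩
  · have h1 : IndepFun (fun ω : CadlagPath (Particle N → ℝ) × (Particle N → ℝ) => ω.1.toFun)
        (fun ω => ω.2) Q := indepFun_prod CadlagPath.measurable_toFun measurable_id
    exact h1.symm.congr hinit'.symm EventuallyEq.rfl
  · filter_upwards [hHae] with ω hω v
    rw [hinit ω hω]
    have h1 := (hH ω hω).1
    exact (hW ω hω).2.2.isReflection (by fun_prop) (hW ω hω).1 v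
  · rw [Measure.map_congr hinit']
    exact hsnd.map_eq

/-! ### Convergence of the rescaled dynamics -/

theorem measurable_rescalePath {N : ℕ} {Ω : Type*} [MeasurableSpace Ω]
    {X : Ω → CadlagPath (Particle N → ℤ)} (hX : Measurable X) (a : C(ℝ≥0, ℝ)) (b : ℝ) :
    Measurable fun ω => rescalePath a b (X ω) := by
  refine CadlagPath.measurable_iff.2 fun t => ?_
  have h : Measurable fun (z : Particle N → ℤ) v => ((z v : ℝ) - a t) / b := Measurable.of_discrete
  exact h.comp (CadlagPath.measurable_iff.1 hX t)

/-- The increments of a path at the points of the grid. -/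
noncomputable def gridIncrement {N : ℕ} (k : ℕ) (x : CadlagPath (Particle N → ℝ)) (j : ℕ) : Particle N → ℝ :=
  x (gridPoint k j) - x 0

theorem continuous_gridIncrement {N : ℕ} (k : ℕ) : Continuous (gridIncrement (N := N) k) :=
  continuous_pi fun _ => (CadlagPath.continuous_eval _).sub (CadlagPath.continuous_eval _)

theorem measurable_gridIncrement {N : ℕ} (k : ℕ) : Measurable (gridIncrement (N := N) k) :=
  measurable_pi_iff.2 fun _ => (CadlagPath.measurable_eval _).sub (CadlagPath.measurable_eval _)

/-- Continuity of `f` alone would not do: `hfm` is needed to make `g ∘ f` an admissible test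
function. -/
theorem WeaklyConverges.tendstoInDistribution {S E : Type*} [TopologicalSpace S]
    [MeasurableSpace S] [TopologicalSpace E] [MeasurableSpace E] [BorelSpace E] {Ω : ℕ → Type*}
    [∀ n, MeasurableSpace (Ω n)] {P : ∀ n, Measure (Ω n)} [∀ n, IsProbabilityMeasure (P n)]
    {X : ∀ n, Ω n → S} {μ : Measure S} [IsProbabilityMeasure μ]
    (h : WeaklyConverges (fun n => (P n).map (X n)) μ) (hX : ∀ n, Measurable (X n)) {f : S → E}
    (hf : Continuous f) (hfm : Measurable f) :
    TendstoInDistribution (fun n ω => f (X n ω)) atTop f P μ where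
  forall_aemeasurable n := (hfm.comp (hX n)).aemeasurable
  aemeasurable_limit := hfm.aemeasurable
  tendsto := by
    refine ProbabilityMeasure.tendsto_iff_forall_integral_tendsto.2 fun g => ?_
    have hgf : Measurable fun x => g (f x) := g.continuous.measurable.comp hfm
    have h1 := h (fun x => g (f x)) (g.continuous.comp hf) hgf
      ⟨‖g‖, fun x => g.norm_coe_le_norm (f x)⟩
    simp only [ProbabilityMeasure.coe_mk]
    rw [integral_map hfm.aemeasurable g.continuous.aestronglyMeasurable]
    refine h1.congr fun n => ?_
    have h2 : AEMeasurable (fun ω => f (X n ω)) (P n) := (hfm.comp (hX n)).aemeasurable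
    rw [integral_map h2 g.continuous.aestronglyMeasurable]
    exact integral_map (hX n).aemeasurable hgf.aestronglyMeasurable

/-- The grid path is the gap-`0` system driven by the frozen path, so both driver and gap differ by
at most `δ`. The horizon `T + 1` is there because the oscillation only sees times strictly before
its horizon. -/
theorem IsReflectedSystem.gridPath_close {N : ℕ} {c δ : ℝ} {T : ℝ≥0} {k : ℕ}
    {x : ℝ≥0 → Particle N → ℝ} {w : ℝ≥0 → Particle N → ℝ}
    (hw : IsReflectedSystem c (fun t v => w 0 v + (x t v - x 0 v)) w) (hw0 : IsInterlaced (w 0))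
    (hx : ∀ t, ContinuousWithinAt x (Set.Ici t) t) (hδ0 : 0 ≤ δ) (hδ1 : δ ≤ 1) (hc : |c| ≤ δ)
    (hosc : gridOscillation (T + 1) k x < δ) :
    ∀ t ≤ T, ∀ v, |gridPath k (w 0, fun j => x (gridPoint k j) - x 0) t v - w t v| ≤
      3 * N * δ := by
  refine (isReflectedSystem_gridPath k hw0 (by simp [gridPoint_zero])).abs_sub_le hw hδ0
    (by simpa using hc) fun t ht v => ?_
  have h := abs_sub_gridPoint_le_of_gridOscillation_lt (T + 1) k hx hδ1 hosc t
    (lt_of_le_of_lt ht (lt_add_one T)) v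
  rw [abs_sub_comm] at h
  refine le_trans (le_of_eq ?_) h
  simp only [Pi.sub_apply]
  congr 1
  ring

theorem exists_scale {N : ℕ} {ε : ℝ} (hε : 0 < ε) : ∃ δ > 0, δ ≤ 1 ∧ 3 * N * δ < ε := by
  refine ⟨min 1 (ε / (3 * N + 1)), lt_min one_pos (by positivity), min_le_left _ _, ?_⟩
  have h : 0 < ε / (3 * (N : ℝ) + 1) := by positivity
  calc 3 * (N : ℝ) * min 1 (ε / (3 * N + 1)) ≤ 3 * N * (ε / (3 * N + 1)) := by
        gcongr
        exact min_le_right _ _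
    _ < (3 * N + 1) * (ε / (3 * N + 1)) := by
        gcongr
        linarith
    _ = ε := by field_simp

/-- The hypotheses on the driving processes and on the initial conditions determine the limit of
the initial condition together with the increments along a grid. -/
theorem tendstoInDistribution_init_gridIncrement {N : ℕ} {Ω : ℕ → Type*}
    [∀ n, MeasurableSpace (Ω n)] {P : ∀ n, Measure (Ω n)} [∀ n, IsProbabilityMeasure (P n)]
    {X Y : ∀ n, Ω n → CadlagPath (Particle N → ℤ)} (hX : ∀ n, Measurable (X n))
    (hind : ∀ n, IndepFun (fun ω => Y n ω 0) (fun ω t => X n ω t - X n ω 0) (P n))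
    {a : ℕ → C(ℝ≥0, ℝ)} {b : ℕ → ℝ} {β : Measure (CadlagPath (Particle N → ℝ))}
    (hβ : IsStandardBrownianMotion (fun t (x : CadlagPath (Particle N → ℝ)) => x t) β)
    (hconv : WeaklyConverges (fun n => (P n).map (fun ω => rescalePath (a n) (b n) (X n ω))) β)
    {μ₀ : Measure (Particle N → ℝ)} [IsProbabilityMeasure μ₀]
    (hinit : TendstoInDistribution (fun n ω => rescalePath (a n) (b n) (Y n ω) 0) atTop id P μ₀)
    {Ω' : Type*} [MeasurableSpace Ω'] {Q : Measure Ω'} [IsProbabilityMeasure Q]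
    {B : ℝ≥0 → Ω' → Particle N → ℝ} {W : Ω' → CadlagPath (Particle N → ℝ)}
    (hW : IsWarrenProcess B W Q) (hW0 : Q.map (fun ω => W ω 0) = μ₀) (k : ℕ) :
    TendstoInDistribution (fun n ω => (rescalePath (a n) (b n) (Y n ω) 0,
      gridIncrement k (rescalePath (a n) (b n) (X n ω)))) atTop
      (fun ω => (W ω 0, fun j => B (gridPoint k j) ω)) P Q := by
  have := hβ.isProbabilityMeasure
  have hgrid : Measurable fun (f : ℝ≥0 → Particle N → ℝ) (j : ℕ) => f (gridPoint k j) :=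
    measurable_pi_iff.2 fun j => measurable_pi_apply _
  have hpath : Measurable fun ω t => B t ω := measurable_pi_iff.2 hW.brownian.measurable
  have hx := hconv.tendstoInDistribution (fun n => measurable_rescalePath (hX n) (a n) (b n))
    (continuous_gridIncrement k) (measurable_gridIncrement k)
  refine tendstoInDistribution_prodMk hinit hx (fun n => ?_)
    ((CadlagPath.measurable_eval 0).comp hW.measurable).aemeasurable
    (hgrid.comp hpath).aemeasurable (hW.indep_init.comp measurable_id hgrid) ?_ ?_
  · have h1 : Measurable fun (z : Particle N → ℤ) v => ((z v : ℝ) - a n 0) / b n :=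
      Measurable.of_discrete
    have h2 : Measurable fun (f : ℝ≥0 → Particle N → ℤ) (j : ℕ) (v : Particle N) =>
        ((f (gridPoint k j) v : ℝ) - (a n (gridPoint k j) - a n 0)) / b n := by
      refine measurable_pi_iff.2 fun j => ?_
      have h3 : Measurable fun (z : Particle N → ℤ) (v : Particle N) =>
          ((z v : ℝ) - (a n (gridPoint k j) - a n 0)) / b n := Measurable.of_discrete
      exact h3.comp (measurable_pi_apply _)
    -- As `a n` is deterministic, the rescaled grid increments are a function of the increments of
    -- `X n` alone, which `hind` covers.
    have h4 : (fun ω => gridIncrement k (rescalePath (a n) (b n) (X n ω))) =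
        (fun (f : ℝ≥0 → Particle N → ℤ) (j : ℕ) (v : Particle N) =>
          ((f (gridPoint k j) v : ℝ) - (a n (gridPoint k j) - a n 0)) / b n) ∘
        fun ω t => X n ω t - X n ω 0 := by
      funext ω j v
      simp only [gridIncrement, rescalePath, Function.comp, Pi.sub_apply]
      push_cast
      ring
    rw [h4]
    exact (hind n).comp h1 h2
  · rw [hW0, Measure.map_id]
  · have h1 := congrArg (fun μ => μ.map fun (f : ℝ≥0 → Particle N → ℝ) (j : ℕ) =>
      f (gridPoint k j)) (hW.brownian.map_eq_map hβ)
    rw [Measure.map_map hgrid hpath, Measure.map_map hgrid CadlagPath.measurable_toFun] at h1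
    refine h1.trans (Measure.map_congr ?_)
    filter_upwards [hβ.ae_zero] with x hx0
    funext j
    simp [gridIncrement, hx0]

theorem weaklyConverges_of_isWarrenProcess {N : ℕ} {Ω : ℕ → Type*} [∀ n, MeasurableSpace (Ω n)]
    {P : ∀ n, Measure (Ω n)} [∀ n, IsProbabilityMeasure (P n)]
    {X Y : ∀ n, Ω n → CadlagPath (Particle N → ℤ)} (hX : ∀ n, Measurable (X n))
    (hsteps : ∀ n ω, HasUnitSteps (X n ω)) (hYm : ∀ n, Measurable (Y n))
    (hY : ∀ n ω, IsInterlacingDynamics (X n ω) (Y n ω))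
    (hind : ∀ n, IndepFun (fun ω => Y n ω 0) (fun ω t => X n ω t - X n ω 0) (P n))
    {a : ℕ → C(ℝ≥0, ℝ)} {b : ℕ → ℝ} (hb_pos : ∀ n, 0 < b n) (hb : Tendsto b atTop atTop)
    {β : Measure (CadlagPath (Particle N → ℝ))}
    (hβ : IsStandardBrownianMotion (fun t (x : CadlagPath (Particle N → ℝ)) => x t) β)
    (hconv : WeaklyConverges (fun n => (P n).map (fun ω => rescalePath (a n) (b n) (X n ω))) β)
    {μ₀ : Measure (Particle N → ℝ)} [IsProbabilityMeasure μ₀]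
    (hinit : TendstoInDistribution (fun n ω => rescalePath (a n) (b n) (Y n ω) 0) atTop id P μ₀)
    {Ω' : Type*} [MeasurableSpace Ω'] {Q : Measure Ω'}
    {B : ℝ≥0 → Ω' → Particle N → ℝ} {W : Ω' → CadlagPath (Particle N → ℝ)}
    (hW : IsWarrenProcess B W Q) (hW0 : Q.map (fun ω => W ω 0) = μ₀) :
    WeaklyConverges (fun n => (P n).map (fun ω => rescalePath (a n) (b n) (Y n ω))) (Q.map W) := by
  have := hβ.isProbabilityMeasure
  have := hW.brownian.isProbabilityMeasure
  have hXr := fun n => measurable_rescalePath (hX n) (a n) (b n)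
  have hYr := fun n => measurable_rescalePath (hYm n) (a n) (b n)
  have hxcad : ∀ x : CadlagPath (Particle N → ℝ), ∀ t, ContinuousWithinAt x.toFun (Set.Ici t) t :=
    fun x t => (x.cadlag t).1
  intro g hg hgm ⟨C, hC⟩
  have key := tendsto_integral_of_approximation (P := P) (Q := Q)
    (Y := fun n ω => rescalePath (a n) (b n) (Y n ω)) (W := W)
    (fun k => continuous_gridPath k)
    (fun k => tendstoInDistribution_init_gridIncrement hX hind hβ hconv hinit hW hW0 k)
    (fun V hV ε hε => ?_) (fun V hV ε hε => ?_) hg hC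
    (fun n => (hgm.comp (hYr n)).aestronglyMeasurable)
    (hgm.comp hW.measurable).aestronglyMeasurable
  · rw [integral_map hW.measurable.aemeasurable hgm.aestronglyMeasurable]
    refine key.congr fun n => ?_
    exact (integral_map (hYr n).aemeasurable hgm.aestronglyMeasurable).symm
  · obtain ⟨⟨T, r⟩, hr, hTr⟩ := (CadlagPath.hasBasis_uniformity N).mem_iff.1 hV
    obtain ⟨δ, hδ, hδ1, hδr⟩ := exists_scale (N := N) hr
    have hβc := hβ.ae_continuous
    filter_upwards [(tendsto_integral_gridOscillation hβ.measurable hβc (T + 1)).eventually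
      (gt_mem_nhds (mul_pos hδ hε))] with k hk
    have hosc : Measurable fun x : CadlagPath (Particle N → ℝ) => gridOscillation (T + 1) k x :=
      (measurable_gridOscillation _ _).comp CadlagPath.measurable_toFun
    -- Taking the oscillation as test function transfers its smallness from Brownian motion to the
    -- drivers for all large `n`, with `k` fixed; this replaces a tightness argument.
    have h1 := hconv (fun x => gridOscillation (T + 1) k x) (continuous_gridOscillation _ _) hosc
      ⟨1, fun x => by
        rw [abs_of_nonneg (gridOscillation_nonneg _ _ _)]
        exact gridOscillation_le_one _ _ _⟩
    have h2 : Tendsto (fun n => 1 / b n) atTop (𝓝 0) := by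
      simpa only [one_div, Function.comp_def] using tendsto_inv_atTop_zero.comp hb
    filter_upwards [h1.eventually (gt_mem_nhds hk), h2.eventually (gt_mem_nhds hδ)] with n hn hn2
    rw [integral_map (hXr n).aemeasurable hosc.aestronglyMeasurable] at hn
    refine (measure_mono fun ω hω => ?_).trans (measure_le_gridOscillation_le
      (fun t => CadlagPath.measurable_iff.1 (hXr n) t) hδ hn.le)
    by_contra hlt
    refine hω (hTr fun t ht v => lt_of_le_of_lt ?_ hδr)
    refine ((hY n ω).isReflectedSystem (hsteps n ω) (a n) (hb_pos n)).gridPath_close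
      ((hY n ω).init.isInterlaced_rescalePath (a n) (hb_pos n)) (hxcad _) hδ.le hδ1 ?_
      (not_le.1 hlt) t ht v
    rw [abs_of_pos (one_div_pos.2 (hb_pos n))]
    exact hn2.le
  · obtain ⟨⟨T, r⟩, hr, hTr⟩ := (CadlagPath.hasBasis_uniformity N).mem_iff.1 hV
    obtain ⟨δ, hδ, hδ1, hδr⟩ := exists_scale (N := N) hr
    filter_upwards [(tendsto_integral_gridOscillation hW.brownian.measurable
      hW.brownian.ae_continuous (T + 1)).eventually (gt_mem_nhds (mul_pos hδ hε))] with k hk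
    refine (measure_mono_ae ?_).trans
      (measure_le_gridOscillation_le hW.brownian.measurable hδ hk.le)
    filter_upwards [hW.brownian.ae_continuous, hW.brownian.ae_zero, hW.reflected]
      with ω hc h0 hrefl hω
    by_contra hlt
    refine hω (hTr fun t ht v => lt_of_le_of_lt ?_ hδr)
    have hsys : IsReflectedSystem 0 (fun t v => W ω 0 v + (B t ω v - B 0 ω v)) (W ω) := by
      refine isReflectedSystem_of_isReflection (by fun_prop) (fun v => by ring) fun v => ?_
      simpa only [h0, Pi.zero_apply, sub_zero] using hrefl v
    have hint : IsInterlaced (W ω 0) := fun v =>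
      ⟨hsys.lower_le 0 v, fun h => by simpa using hsys.le_upper 0 v h⟩
    have h1 := hsys.gridPath_close (k := k) (x := fun t => B t ω) hint
      (fun t => hc.continuousWithinAt) hδ.le hδ1
      (by simpa using hδ.le) (not_le.1 hlt) t ht v
    simpa only [h0, sub_zero] using h1

/-- The interlaced arrays form a closed set of full measure before the limit, so portmanteau
preserves this. -/
theorem ae_isInterlaced_of_tendsto {N : ℕ} {Ω : ℕ → Type*} [∀ n, MeasurableSpace (Ω n)]
    {P : ∀ n, Measure (Ω n)} [∀ n, IsProbabilityMeasure (P n)] {Z : ∀ n, Ω n → Particle N → ℝ}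
    {μ₀ : Measure (Particle N → ℝ)} [IsProbabilityMeasure μ₀]
    (hZ : TendstoInDistribution Z atTop id P μ₀) (h : ∀ n ω, IsInterlaced (Z n ω)) :
    ∀ᵐ y ∂μ₀, IsInterlaced y := by
  have hF := isClosed_isInterlaced N
  have h1 := ProbabilityMeasure.limsup_measure_closed_le_of_tendsto hZ.tendsto hF
  have h2 : ∀ n, (P n).map (Z n) {x | IsInterlaced x} = 1 := fun n => by
    rw [Measure.map_apply_of_aemeasurable (hZ.forall_aemeasurable n) hF.measurableSet]
    have : Z n ⁻¹' {x | IsInterlaced x} = Set.univ := Set.eq_univ_of_forall (h n)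
    rw [this, measure_univ]
  simp only [ProbabilityMeasure.coe_mk, h2, Measure.map_id, limsup_const] at h1
  exact (mem_ae_iff_prob_eq_one hF.measurableSet).2 (le_antisymm prob_le_one h1)

theorem theorem1 (N : ℕ) {Ω : ℕ → Type*} [∀ n, MeasurableSpace (Ω n)]
    (P : ∀ n, Measure (Ω n)) [∀ n, IsProbabilityMeasure (P n)]
    -- the driving processes
    (X : ∀ n, Ω n → CadlagPath (Particle N → ℤ))
    (hX_meas : ∀ n, Measurable (X n))
    (hX_steps : ∀ n ω, HasUnitSteps (X n ω))
    -- the interlacing dynamics they drive, with initial conditions independent of the increments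
    (Y : ∀ n, Ω n → CadlagPath (Particle N → ℤ))
    (hY : ∀ n ω, IsInterlacingDynamics (X n ω) (Y n ω))
    (hY_init_meas : ∀ n, Measurable (fun ω => Y n ω 0))
    (hY_indep : ∀ n, IndepFun (fun ω => Y n ω 0) (fun ω t => X n ω t - X n ω 0) (P n))
    -- the scaling
    (a : ℕ → C(ℝ≥0, ℝ)) (b : ℕ → ℝ) (hb_pos : ∀ n, 0 < b n) (hb : Tendsto b atTop atTop)
    -- convergence of the rescaled driving processes to the law `β` of standard Brownian motion
    (β : Measure (CadlagPath (Particle N → ℝ)))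
    (hβ : IsStandardBrownianMotion (fun t (x : CadlagPath (Particle N → ℝ)) => x t) β)
    (hX_conv : WeaklyConverges (fun n => (P n).map (fun ω => rescalePath (a n) (b n) (X n ω))) β)
    -- convergence of the rescaled initial conditions to the law `μ₀`
    (μ₀ : Measure (Particle N → ℝ)) [IsProbabilityMeasure μ₀]
    (hY_init_conv : TendstoInDistribution
      (fun n ω => rescalePath (a n) (b n) (Y n ω) 0) atTop id P μ₀) :
    (∀ n, Measurable (Y n)) ∧
    (∃ ν, IsWarrenLaw μ₀ ν) ∧
    ∀ ν, IsWarrenLaw μ₀ ν →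
      WeaklyConverges (fun n => (P n).map (fun ω => rescalePath (a n) (b n) (Y n ω))) ν := by
  have hYm : ∀ n, Measurable (Y n) := fun n =>
    measurable_of_isInterlacingDynamics (hX_meas n) (hY n) (hY_init_meas n)
  refine ⟨hYm, exists_isWarrenLaw hβ μ₀ ?_, ?_⟩
  · exact ae_isInterlaced_of_tendsto hY_init_conv fun n ω =>
      (hY n ω).init.isInterlaced_rescalePath (a n) (hb_pos n)
  · rintro ν ⟨Ω', _, Q, B, W, hW, hW0, rfl⟩
    exact weaklyConverges_of_isWarrenProcess hX_meas hX_steps hYm hY hY_indep hb_pos hb hβ hX_conv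
      hY_init_conv hW hW0
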